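/- \textbf{Setting.} Let $E=(E^0,E^1,r,s)$ be a finite directed graph with no sources and no sinks (every vertex is $r(e)$ for some edge $e$, and is $s(e)$ for some edge $e$). Paths are strings $e_1\dots e_n$ of edges with $s(e_i)=r(e_{i+1})$, vertices being the paths of length $0$; $E^n$ is the set of paths of length $n$, $E^*=\bigcup_{n\ge 0}E^n$, and $E^\infty$, $E^{-\infty}$, $E^{\mathbb Z}$ are the right-, left- and bi-infinite paths with the cylinder-set topologies. Let $G$ be a groupoid with unit space $E^0$, with domain and codomain maps $d,c$, acting faithfully on $E^*$: each $g\in G$ acts as a bijection $d(g)E^*\to c(g)E^*$ that preserves length and satisfies $g\cdot(\mu e)\in (g\cdot\mu)E^1$; units act as identities, products as composites, and distinct elements act differently. Suppose $(G,E)$ is self-similar: for $g\in G$ and $e\in d(g)E^1$ there is a (necessarily unique) $g|_e\in G$ with $g\cdot(e\mu)=(g\cdot e)(g|_e\cdot\mu)$ for all $\mu\in s(e)E^*$; for paths let $g|_\mu$ be the unique element with $g\cdot(\mu\nu)=(g\cdot\mu)(g|_\mu\cdot\nu)$ for all $\nu \in s(\mu)E^*$. Suppose $(G,E)$ is \emph{contracting}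 (there is a finite $F\subseteq G$ such that for every $g\in G$ there is $n\ge 0$ with $\{g|_\mu:\mu\in d(g)E^n\}\subseteq F$) and \emph{regular} (if $g\cdot y=y$ with $y\in E^\infty$, then some initial segment $\mu$ of $y$ satisfies $g\cdot\mu=\mu$ and $g|_\mu=s(\mu)$). For $x,y\in E^{-\infty}$ write $x\sim_{ae}y$ if there are $g_n\in G$ $(n<0)$, taking finitely many values, with $g_n\cdot x_n\dots x_{-1}=y_n\dots y_{-1}$ for all $n<0$; for $x,y\in E^{\mathbb Z}$ write $x\sim_{ae}y$ if there are $g_n\in G$ $(n\in\mathbb Z)$, taking finitely many values, with $g_n\cdot x_nx_{n+1}\dots=y_ny_{n+1}\dots$ for all $n$. Let $\mathcal J=E^{-\infty}/{\sim_{ae}}$ be the limit space and $\mathcal S=E^{\mathbb Z}/{\sim_{ae}}$ the limit solenoid, with the quotient topologies; let $\tilde\sigma:\mathcal J\to\mathcal J$ be induced by $\sigma(\dots x_{-2}x_{-1})=\dots x_{-3}x_{-2}$, let $\tau(x)_n=x_{n-1}$ on $E^{\mathbb Z}$, and put $x(-\infty,m)=\dots x_{m-1}x_m\in E^{-\infty}$.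 Call $(d_{\mathcal J},\varepsilon,c)$ an \emph{expanding metric} if $\varepsilon>0$, $c>1$ and $d_{\mathcal J}$ is a metric inducing the topology of $\mathcal J$ such that $d_{\mathcal J}(\tilde\sigma z,\tilde\sigma z')=c\,d_{\mathcal J}(z,z')$ whenever $d_{\mathcal J}(z,z')<\varepsilon$, and $\tilde\sigma(B(z,\alpha))=B(\tilde\sigma z,c\alpha)$ for all $z \in \mathcal J$ and $\alpha\le\varepsilon$ (open balls). A \emph{Smale space} $(X,d,\varphi,\varepsilon_X,\lambda)$ is a compact metric space $(X,d)$ with a homeomorphism $\varphi$, constants $\varepsilon_X>0$, $0<\lambda<1$, and a continuous bracket $[\cdot,\cdot]:\{d(x,y)\le\varepsilon_X\}\to X$ such that $[x,x]=x$; $[x,[y,z]]=[x,z]$, $[[x,y],z]=[x,z]$ and $\varphi[x,y]=[\varphi x,\varphi y]$ whenever both sides are defined; $d(\varphi x,\varphi y)\le\lambda d(x,y)$ if $[x,y]=y$; and $d(\varphi^{-1}x,\varphi^{-1}y)\le\lambda d(x,y)$ if $[x,y]=x$. Its local stable sets are $X^s(x,\delta)=\{y:d(x,y)<\delta,\ [y,x]=x\}$,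 $0<\delta\le\varepsilon_X$; its global stable sets are $X^s(x)=\{y:d(\varphi^nx,\varphi^ny)\to0 \text{ as } n\to\infty\}$ with the topology generated by the sets $X^s(y,\delta)$, $y\in X^s(x)$, $0<\delta<\varepsilon_X$. \textbf{Statement.} \begin{enumerate} \item There is a homeomorphism $\tilde\tau:\mathcal S\to\mathcal S$ with $\tilde\tau([x])=[\tau(x)]$ for all $x\in E^{\mathbb Z}$. \item Expanding metrics $(d_{\mathcal J},\varepsilon,c)$ on $\mathcal J$ exist. For every such triple there is a metric $d_{\mathcal S}$ on $\mathcal S$, inducing its topology, with \[ d_{\mathcal S}([x],[y])=\sup_{m\ge0}\,(1/c)^m\, d_{\mathcal J}\big([x(-\infty,m)],[y(-\infty,m)]\big)\qquad(x,y\in E^{\mathbb Z}), \] and there is a constant $\varepsilon_{\mathcal S}>0$ such that $(\mathcal S,d_{\mathcal S},\tilde\tau,\varepsilon_{\mathcal S},1/c)$ is a Smale space (for some bracket) whose stable sets, local (as subspaces) and global, are totally disconnected. \item If $E$ is strongly connected ($E$ has an edge and $vE^*w\neq\varnothing$ for all $v,w\in E^0$), then $(\mathcal S,\tilde\tau)$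 is irreducible: for all non-empty open $U,W\subseteq\mathcal S$ there is $N\ge0$ with $\tilde\tau^N(U)\cap W\ne\varnothing$. \item If $E$ is primitive (for some $n\ge1$, $vE^nw\neq\varnothing$ for all $v,w\in E^0$), then $(\mathcal S,\tilde\tau)$ is topologically mixing: for all non-empty open $U,W\subseteq\mathcal S$ there is $N$ with $\tilde\tau^n(U)\cap W\ne\varnothing$ for all $n\ge N$. \end{enumerate} -/

import Mathlib

open CategoryTheory Filter Topology

universe u v w

/-- A directed graph with vertex set `V` and edge set `Edge`; the edge `e` points from `s e` to
`r e`. -/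
structure DirectedGraph (V : Type u) (Edge : Type v) where
  r : Edge → V
  s : Edge → V

namespace DirectedGraph

variable {V : Type u} {Edge : Type v} (E : DirectedGraph V Edge)

/-- `E.IsPath v [e₁, …, eₙ]`: the string `e₁ … eₙ` is a path (`s eᵢ = r eᵢ₊₁`) with range `v`.
The empty string, read with range `v`, is the vertex `v` regarded as a path of length `0`. -/
def IsPath : V → List Edge → Prop
  | _, [] => True
  | v, e :: μ => E.r e = v ∧ IsPath (E.s e) μ

/-- The source of a path with range `v`. -/
def source : V → List Edge → V
  | v, [] => v
  | _, e :: μ => source (E.s e) μ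

theorem isPath_append {E : DirectedGraph V Edge} {v : V} {μ ν : List Edge} (hμ : E.IsPath v μ)
    (hν : E.IsPath (E.source v μ) ν) : E.IsPath v (μ ++ ν) := by
  induction μ generalizing v with
  | nil => simpa [source] using hν
  | cons e μ ih => exact ⟨hμ.1, ih hμ.2 hν⟩

/-- The set `v E^*` of finite paths with range `v`. -/
abbrev PathsTo (v : V) : Type v := {μ : List Edge // E.IsPath v μ}

/-- Every vertex receives an edge: `v E^1 ≠ ∅` for all `v`. -/
def NoSources : Prop := ∀ v : V, ∃ e : Edge, E.r e = v

/-- Every vertex emits an edge: `E^1 v ≠ ∅` for all `v`. -/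
def NoSinks : Prop := ∀ v : V, ∃ e : Edge, E.s e = v

/-- `E` has an edge, and `v E^* w ≠ ∅` for all vertices `v`, `w`. -/
def StronglyConnected : Prop :=
  Nonempty Edge ∧ ∀ v w : V, ∃ μ : List Edge, E.IsPath v μ ∧ E.source v μ = w

/-- There is `n ≥ 1` such that `v E^n w ≠ ∅` for all vertices `v`, `w`. -/
def Primitive : Prop :=
  ∃ n : ℕ, 1 ≤ n ∧ ∀ v w : V, ∃ μ : List Edge, μ.length = n ∧ E.IsPath v μ ∧ E.source v μ = w

/-- Right-infinite paths `y₁ y₂ y₃ …`; the edge `y_{k+1}` is stored at `k`. -/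
structure RightPath where
  edge : ℕ → Edge
  chain : ∀ k, E.s (edge k) = E.r (edge (k + 1))

/-- Left-infinite paths `… x₋₃ x₋₂ x₋₁`; the edge `x_{-(k+1)}` is stored at `k`. -/
structure LeftPath where
  edge : ℕ → Edge
  chain : ∀ k, E.s (edge (k + 1)) = E.r (edge k)

/-- Bi-infinite paths `… x₋₁ x₀ x₁ …`. -/
structure BiPath where
  edge : ℤ → Edge
  chain : ∀ n, E.s (edge n) = E.r (edge (n + 1))

/-- The topology of left-infinite paths: cylinder sets, that is, the restriction of the product
of the discrete topologies. -/
instance : TopologicalSpace E.LeftPath :=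
  TopologicalSpace.induced (fun x : E.LeftPath => x.edge)
    (@Pi.topologicalSpace ℕ (fun _ => Edge) (fun _ => ⊥))

/-- The topology of bi-infinite paths: cylinder sets, that is, the restriction of the product
of the discrete topologies. -/
instance : TopologicalSpace E.BiPath :=
  TopologicalSpace.induced (fun x : E.BiPath => x.edge)
    (@Pi.topologicalSpace ℤ (fun _ => Edge) (fun _ => ⊥))

variable {E}

/-- The initial segment `y₁ … yₙ`. -/
def RightPath.initial (y : E.RightPath) (n : ℕ) : List Edge := (List.range n).map y.edge

/-- The range `r(y₁)`. -/
def RightPath.range (y : E.RightPath) : V := E.r (y.edge 0)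

/-- The final segment `x₋ₙ … x₋₁`. -/
def LeftPath.final (x : E.LeftPath) (n : ℕ) : List Edge := (List.range n).reverse.map x.edge

/-- The shift `σ(… x₋₃ x₋₂ x₋₁) = … x₋₃ x₋₂`. -/
def LeftPath.shift (x : E.LeftPath) : E.LeftPath :=
  ⟨fun k => x.edge (k + 1), fun k => x.chain (k + 1)⟩

/-- The segment `xₙ xₙ₊₁ … xₙ₊ₖ₋₁`. -/
def BiPath.segment (x : E.BiPath) (n : ℤ) (k : ℕ) : List Edge :=
  (List.range k).map fun i : ℕ => x.edge (n + i)

/-- The translation `τ(x)ₙ = xₙ₋₁`. -/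
def BiPath.translate (x : E.BiPath) : E.BiPath :=
  ⟨fun n => x.edge (n - 1), fun n => by
    rw [x.chain (n - 1)]; congr 2; omega⟩

/-- The left-infinite path `x(-∞, n) = … xₙ₋₂ xₙ₋₁ xₙ`. -/
def BiPath.leftPart (x : E.BiPath) (n : ℤ) : E.LeftPath :=
  ⟨fun k => x.edge (n - k), fun k => by
    rw [x.chain (n - ((k + 1 : ℕ) : ℤ))]; congr 2; omega⟩

theorem RightPath.isPath_initial (y : E.RightPath) (n : ℕ) : E.IsPath y.range (y.initial n) := by
  have key : ∀ (n j : ℕ), E.IsPath (E.r (y.edge j)) ((List.range n).map fun i => y.edge (j + i)) := by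
    intro n
    induction n with
    | zero => intro j; simp [IsPath]
    | succ n ih =>
      intro j
      rw [List.range_succ_eq_map]
      simp only [List.map_cons, List.map_map, IsPath]
      refine ⟨by simp, ?_⟩
      have h := ih (j + 1)
      rw [← y.chain j] at h
      have e : ((fun i => y.edge (j + i)) ∘ Nat.succ) = fun i => y.edge (j + 1 + i) := by
        funext i
        simp only [Function.comp_apply]
        congr 1
        omega
      rw [e]
      exact h
  simpa [RightPath.range, RightPath.initial] using key n 0

theorem LeftPath.isPath_final (x : E.LeftPath) (n : ℕ) :
    E.IsPath (E.r (x.edge n)) (x.final (n + 1)) := by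
  induction n with
  | zero => simp [LeftPath.final, IsPath]
  | succ n ih =>
    have : x.final (n + 1 + 1) = x.edge (n + 1) :: x.final (n + 1) := by
      simp [LeftPath.final, List.range_succ]
    rw [this]
    exact ⟨rfl, by rw [x.chain n]; exact ih⟩

theorem LeftPath.final_shift (x : E.LeftPath) (n : ℕ) :
    x.final (n + 1) = x.shift.final n ++ [x.edge 0] := by
  simp [LeftPath.final, LeftPath.shift, List.range_succ_eq_map, List.map_reverse, Function.comp_def]

theorem BiPath.isPath_segment (x : E.BiPath) (n : ℤ) (k : ℕ) :
    E.IsPath (E.r (x.edge n)) (x.segment n k) := by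
  induction k generalizing n with
  | zero => simp [BiPath.segment, IsPath]
  | succ k ih =>
    have h := ih (n + 1)
    rw [← x.chain n] at h
    unfold BiPath.segment at h ⊢
    rw [List.range_succ_eq_map]
    rw [List.map_cons, List.map_map]
    refine ⟨by simp, ?_⟩
    have e : ((fun i : ℕ => x.edge (n + i)) ∘ Nat.succ) = fun i : ℕ => x.edge (n + 1 + i) := by
      funext i
      show x.edge (n + ((i + 1 : ℕ) : ℤ)) = _
      congr 1
      omega
    have e0 : n + ((0 : ℕ) : ℤ) = n := by simp
    rw [e, e0]
    exact h

variable (E)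

/-- Partial isomorphisms `v E^* → w E^*`: length-preserving bijections `g` with
`g (μ e) ∈ g (μ) E^1`. -/
structure PartialIso (v w : V) extends E.PathsTo v ≃ E.PathsTo w where
  length_map : ∀ μ : E.PathsTo v, (toFun μ).1.length = μ.1.length
  map_concat : ∀ (μ μe : E.PathsTo v) (e : Edge), μe.1 = μ.1 ++ [e] →
    ∃ f : Edge, (toFun μe).1 = (toFun μ).1 ++ [f]

end DirectedGraph

open DirectedGraph

/-- A self-similar groupoid action `(G, E)`. The groupoid `G` has unit space `V`: its elements with
domain `v` and codomain `w` are the morphisms `v ⟶ w`, and the product `h g` is `g ≫ h`.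
It acts faithfully by partial isomorphisms, and for every `g` and every edge `e` with
`r e = d(g)` there is `h ∈ G` with `g · (e μ) = (g · e) (h · μ)` for all `μ ∈ s(e) E^*`. -/
structure SelfSimilarAction {V : Type u} {Edge : Type v} (E : DirectedGraph V Edge)
    [Groupoid.{w} V] where
  toPartialIso : ∀ {v w : V}, (v ⟶ w) → E.PartialIso v w
  map_id : ∀ (v : V) (μ : E.PathsTo v), (toPartialIso (𝟙 v)).toEquiv μ = μ
  map_comp : ∀ {u v w : V} (g : u ⟶ v) (h : v ⟶ w) (μ : E.PathsTo u),
    (toPartialIso (g ≫ h)).toEquiv μ = (toPartialIso h).toEquiv ((toPartialIso g).toEquiv μ)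
  faithful : ∀ v w : V, Function.Injective (fun g : v ⟶ w => toPartialIso g)
  self_similar : ∀ {v w : V} (g : v ⟶ w) (e : Edge) (he : E.r e = v),
    ∃ (f : Edge) (h : E.s e ⟶ E.s f), ∀ μ : E.PathsTo (E.s e),
      ((toPartialIso g).toEquiv ⟨e :: μ.1, he, μ.2⟩).1 = f :: ((toPartialIso h).toEquiv μ).1

/-- The set of all elements of a groupoid with unit space `V`: triples (domain, codomain,
morphism). -/
abbrev GroupoidElt (V : Type u) [Groupoid.{w} V] := Σ v w : V, (v ⟶ w)

namespace SelfSimilarAction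

variable {V : Type u} {Edge : Type v} {E : DirectedGraph V Edge} [Groupoid.{w} V]
  (A : SelfSimilarAction E)

/-- The path `g · μ`. -/
def act {v w : V} (g : v ⟶ w) (μ : E.PathsTo v) : E.PathsTo w := (A.toPartialIso g).toEquiv μ

theorem exists_restriction {v w : V} (g : v ⟶ w) (μ : E.PathsTo v) :
    ∃ h : E.source v μ.1 ⟶ E.source w (A.act g μ).1, ∀ ν : E.PathsTo (E.source v μ.1),
      (A.act g ⟨μ.1 ++ ν.1, isPath_append μ.2 ν.2⟩).1 = (A.act g μ).1 ++ (A.act h ν).1 := by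
  obtain ⟨μ, hμ⟩ := μ
  suffices H : ∃ (u : V) (h : E.source v μ ⟶ u), u = E.source w (A.act g ⟨μ, hμ⟩).1 ∧
      ∀ ν : E.PathsTo (E.source v μ),
        (A.act g ⟨μ ++ ν.1, isPath_append hμ ν.2⟩).1 = (A.act g ⟨μ, hμ⟩).1 ++ (A.act h ν).1 by
    obtain ⟨u, h, rfl, hh⟩ := H
    exact ⟨h, hh⟩
  induction μ generalizing v w with
  | nil =>
    have h0 : (A.act g ⟨[], hμ⟩).1 = [] := by
      have := (A.toPartialIso g).length_map ⟨[], hμ⟩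
      exact List.length_eq_zero_iff.1 this
    refine ⟨w, g, by rw [h0]; rfl, fun ν => ?_⟩
    rw [h0]; rfl
  | cons e μ ih =>
    obtain ⟨f, k, hk⟩ := A.self_similar g e hμ.1
    obtain ⟨u, h, hu, hh⟩ := ih k hμ.2
    have h1 : (A.act g ⟨e :: μ, hμ⟩).1 = f :: (A.act k ⟨μ, hμ.2⟩).1 := hk ⟨μ, hμ.2⟩
    refine ⟨u, h, ?_, fun ν => ?_⟩
    · rw [h1]; exact hu
    · rw [h1]
      refine Eq.trans ?_ (congrArg (fun l => f :: l) (hh ν))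
      exact hk ⟨μ ++ ν.1, isPath_append hμ.2 ν.2⟩

/-- The restriction `g|_μ`: the element `h` of `G` (unique by faithfulness), with domain `s(μ)` and
codomain `s(g · μ)`, such that `g · (μ ν) = (g · μ) (h · ν)` for all `ν ∈ s(μ) E^*`. -/
noncomputable def restrict {v w : V} (g : v ⟶ w) (μ : E.PathsTo v) :
    E.source v μ.1 ⟶ E.source w (A.act g μ).1 :=
  (A.exists_restriction g μ).choose

theorem restrict_spec {v w : V} (g : v ⟶ w) (μ : E.PathsTo v) (ν : E.PathsTo (E.source v μ.1)) :
    (A.act g ⟨μ.1 ++ ν.1, isPath_append μ.2 ν.2⟩).1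
      = (A.act g μ).1 ++ (A.act (A.restrict g μ) ν).1 :=
  (A.exists_restriction g μ).choose_spec ν

/-- The restriction `g|_μ` as an element of the set `G`. -/
noncomputable def restrictElt {v w : V} (g : v ⟶ w) (μ : E.PathsTo v) : GroupoidElt V :=
  ⟨_, _, A.restrict g μ⟩

/-- `(G, E)` is contracting: there is a finite `F ⊆ G` such that for every `g ∈ G` there is `n ≥ 0`
with `{g|_μ : μ ∈ d(g) E^n} ⊆ F`. -/
def IsContracting : Prop :=
  ∃ F : Set (GroupoidElt V), F.Finite ∧ ∀ (v w : V) (g : v ⟶ w), ∃ n : ℕ,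
    ∀ μ : E.PathsTo v, μ.1.length = n → A.restrictElt g μ ∈ F

/-- `(G, E)` is regular: if `g · y = y` for a right-infinite path `y`, then `g · μ = μ` and
`g|_μ = s(μ)` for some initial segment `μ` of `y`. As `g · y = y` forces `c(g) = r(y) = d(g)`,
only `g` with this domain and codomain need be considered; `g · y = y` means that `g` fixes all
initial segments of `y`. -/
def IsRegular : Prop :=
  ∀ (y : E.RightPath) (g : y.range ⟶ y.range),
    (∀ n : ℕ, A.act g ⟨y.initial n, y.isPath_initial n⟩ = ⟨y.initial n, y.isPath_initial n⟩) →
    ∃ n : ℕ,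
      A.act g ⟨y.initial n, y.isPath_initial n⟩ = ⟨y.initial n, y.isPath_initial n⟩ ∧
      A.restrictElt g ⟨y.initial n, y.isPath_initial n⟩ =
        ⟨E.source y.range (y.initial n), E.source y.range (y.initial n), 𝟙 _⟩

/-- `g · μ` is defined and equal to `ν`. -/
def MapsTo (g : GroupoidElt V) (μ ν : List Edge) : Prop :=
  ∃ h : E.IsPath g.1 μ, (A.act g.2.2 ⟨μ, h⟩).1 = ν

variable {A}

theorem mapsTo_id {v : V} {μ : List Edge} (h : E.IsPath v μ) : A.MapsTo ⟨v, v, 𝟙 v⟩ μ μ :=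
  ⟨h, by simp [act, A.map_id]⟩

theorem MapsTo.length_eq {g : GroupoidElt V} {μ ν : List Edge} (h : A.MapsTo g μ ν) :
    ν.length = μ.length := by
  obtain ⟨h, rfl⟩ := h
  exact (A.toPartialIso g.2.2).length_map _

theorem MapsTo.inv {g : GroupoidElt V} {μ ν : List Edge} (h : A.MapsTo g μ ν) :
    A.MapsTo ⟨g.2.1, g.1, Groupoid.inv g.2.2⟩ ν μ := by
  obtain ⟨h, rfl⟩ := h
  refine ⟨(A.act g.2.2 ⟨μ, h⟩).2, ?_⟩
  have := A.map_comp g.2.2 (Groupoid.inv g.2.2) ⟨μ, h⟩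
  rw [Groupoid.comp_inv, A.map_id] at this
  exact congrArg Subtype.val this.symm

/-- The product `h g` of composable elements (and `g` if the two are not composable). -/
noncomputable def eltMul (h g : GroupoidElt V) : GroupoidElt V := by
  classical
  exact if e : g.2.1 = h.1 then ⟨g.1, h.2.1, g.2.2 ≫ eqToHom e ≫ h.2.2⟩ else g

theorem MapsTo.mul {g h : GroupoidElt V} {μ ν κ : List Edge} (hμ : μ ≠ [])
    (hg : A.MapsTo g μ ν) (hh : A.MapsTo h ν κ) : A.MapsTo (eltMul h g) μ κ := by
  have hl := hg.length_eq
  obtain ⟨p, rfl⟩ := hg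
  obtain ⟨q, rfl⟩ := hh
  obtain ⟨a, b, g⟩ := g
  obtain ⟨c, d, h⟩ := h
  have e : b = c := by
    generalize hη : A.act g ⟨μ, p⟩ = η at q hl
    obtain ⟨η, hη'⟩ := η
    cases η with
    | nil => exact absurd (List.length_eq_zero_iff.1 hl.symm) hμ
    | cons x l => exact hη'.1.symm.trans q.1
  subst e
  have e : eltMul ⟨b, d, h⟩ ⟨a, b, g⟩ = ⟨a, d, g ≫ h⟩ := by simp [eltMul]
  rw [e]
  exact ⟨p, congrArg Subtype.val (A.map_comp g h ⟨μ, p⟩)⟩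

theorem MapsTo.of_concat {g : GroupoidElt V} {μ ν : List Edge} {e f : Edge}
    (h : A.MapsTo g (μ ++ [e]) (ν ++ [f])) : A.MapsTo g μ ν := by
  obtain ⟨p, hp⟩ := h
  have q : ∀ (v : V) (μ : List Edge), E.IsPath v (μ ++ [e]) → E.IsPath v μ := by
    intro v μ
    induction μ generalizing v with
    | nil => intro _; trivial
    | cons x μ ih => intro h; exact ⟨h.1, ih _ h.2⟩
  refine ⟨q _ _ p, ?_⟩
  obtain ⟨f', hf⟩ := (A.toPartialIso g.2.2).map_concat ⟨μ, q _ _ p⟩ ⟨μ ++ [e], p⟩ e rfl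
  have := hp.symm.trans hf
  exact (List.append_inj' this rfl).1.symm

variable (A)

/-- Asymptotic equivalence of left-infinite paths: there is a sequence `(gₙ)_{n<0}` in `G` with
finitely many values and `gₙ · xₙ … x₋₁ = yₙ … y₋₁` for all `n < 0`; here `g₋₍ₙ₊₁₎` is stored at
`n`. -/
def LeftAsymp (x y : E.LeftPath) : Prop :=
  ∃ g : ℕ → GroupoidElt V, (Set.range g).Finite ∧
    ∀ n : ℕ, A.MapsTo (g n) (x.final (n + 1)) (y.final (n + 1))

/-- Asymptotic equivalence of bi-infinite paths: there is a sequence `(gₙ)_{n∈ℤ}` in `G` with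
finitely many values and `gₙ · xₙ xₙ₊₁ … = yₙ yₙ₊₁ …` for all `n`, that is, `gₙ` sends
every initial segment of the first path to that of the second. -/
def BiAsymp (x y : E.BiPath) : Prop :=
  ∃ g : ℤ → GroupoidElt V, (Set.range g).Finite ∧
    ∀ (n : ℤ) (k : ℕ), A.MapsTo (g n) (x.segment n k) (y.segment n k)

theorem finite_units [Finite V] {ι : Type*} (f : ι → V) :
    (Set.range fun n => (⟨f n, f n, 𝟙 (f n)⟩ : GroupoidElt V)).Finite :=
  (Set.finite_range fun v : V => (⟨v, v, 𝟙 v⟩ : GroupoidElt V)).subset (by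
    rintro _ ⟨n, rfl⟩; exact ⟨f n, rfl⟩)

theorem finite_inv {ι : Type*} {g : ι → GroupoidElt V} (hg : (Set.range g).Finite) :
    (Set.range fun n => (⟨(g n).2.1, (g n).1, Groupoid.inv (g n).2.2⟩ : GroupoidElt V)).Finite :=
  (hg.image fun k => (⟨k.2.1, k.1, Groupoid.inv k.2.2⟩ : GroupoidElt V)).subset (by
    rintro _ ⟨n, rfl⟩; exact ⟨g n, ⟨n, rfl⟩, rfl⟩)

theorem finite_mul {ι : Type*} {g h : ι → GroupoidElt V} (hg : (Set.range g).Finite)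
    (hh : (Set.range h).Finite) : (Set.range fun n => eltMul (h n) (g n)).Finite :=
  (hh.image2 eltMul hg).subset (by
    rintro _ ⟨n, rfl⟩; exact ⟨h n, ⟨n, rfl⟩, g n, ⟨n, rfl⟩, rfl⟩)

/-- Asymptotic equivalence on `E^{-∞}`. -/
def leftSetoid [Finite V] : Setoid E.LeftPath where
  r := A.LeftAsymp
  iseqv :=
    { refl := fun x => ⟨fun n => ⟨E.r (x.edge n), E.r (x.edge n), 𝟙 _⟩, finite_units _,
        fun n => mapsTo_id (x.isPath_final n)⟩
      symm := fun ⟨g, hg, h⟩ => ⟨_, finite_inv hg, fun n => (h n).inv⟩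
      trans := fun ⟨g, hg, h⟩ ⟨g', hg', h'⟩ => ⟨_, finite_mul hg hg', fun n =>
        MapsTo.mul (by simp [LeftPath.final, List.range_succ]) (h n) (h' n)⟩ }

/-- Asymptotic equivalence on `E^ℤ`. -/
def biSetoid [Finite V] : Setoid E.BiPath where
  r := A.BiAsymp
  iseqv :=
    { refl := fun x => ⟨fun n => ⟨E.r (x.edge n), E.r (x.edge n), 𝟙 _⟩, finite_units _,
        fun n k => mapsTo_id (x.isPath_segment n k)⟩
      symm := fun ⟨g, hg, h⟩ => ⟨_, finite_inv hg, fun n k => (h n k).inv⟩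
      trans := fun {x y z} ⟨g, hg, h⟩ ⟨g', hg', h'⟩ => ⟨_, finite_mul hg hg', fun n k => by
        have key := fun k => MapsTo.mul (A := A) (μ := x.segment n (k + 1))
          (by simp [BiPath.segment, List.range_succ]) (h n (k + 1)) (h' n (k + 1))
        refine MapsTo.of_concat (e := x.edge (n + k)) (f := z.edge (n + k)) ?_
        simpa [BiPath.segment, List.range_succ] using key k⟩ }

/-- The limit space `𝒥 = E^{-∞}/∼`, with the quotient topology. -/
def LimitSpace [Finite V] : Type v := Quotient A.leftSetoid

instance [Finite V] : TopologicalSpace A.LimitSpace :=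
  inferInstanceAs (TopologicalSpace (Quotient A.leftSetoid))

/-- The class `[x] ∈ 𝒥` of a left-infinite path. -/
def toLimitSpace [Finite V] (x : E.LeftPath) : A.LimitSpace := Quotient.mk A.leftSetoid x

/-- The limit solenoid `𝒮 = E^ℤ/∼`, with the quotient topology. -/
def Solenoid [Finite V] : Type v := Quotient A.biSetoid

instance [Finite V] : TopologicalSpace A.Solenoid :=
  inferInstanceAs (TopologicalSpace (Quotient A.biSetoid))

/-- The class `[x] ∈ 𝒮` of a bi-infinite path. -/
def toSolenoid [Finite V] (x : E.BiPath) : A.Solenoid := Quotient.mk A.biSetoid x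

theorem LeftAsymp.shift {x y : E.LeftPath} (h : A.LeftAsymp x y) :
    A.LeftAsymp x.shift y.shift := by
  obtain ⟨g, hg, h⟩ := h
  refine ⟨fun n => g (n + 1), hg.subset (by rintro _ ⟨n, rfl⟩; exact ⟨n + 1, rfl⟩), fun n => ?_⟩
  have := h (n + 1)
  rw [LeftPath.final_shift, LeftPath.final_shift y] at this
  exact this.of_concat

/-- The map `σ̃ : 𝒥 → 𝒥`, `[x] ↦ [σ(x)]`. -/
def shiftLimit [Finite V] : A.LimitSpace → A.LimitSpace :=
  Quotient.map' (s₁ := A.leftSetoid) (s₂ := A.leftSetoid) LeftPath.shift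
    fun _ _ h => LeftAsymp.shift A h

end SelfSimilarAction

/-- `d` is a metric on `X` which induces the given topology of `X`. -/
structure IsCompatibleMetric {X : Type*} [TopologicalSpace X] (d : X → X → ℝ) : Prop where
  self : ∀ x, d x x = 0
  eq_of_zero : ∀ x y, d x y = 0 → x = y
  comm : ∀ x y, d x y = d y x
  triangle : ∀ x y z, d x z ≤ d x y + d y z
  isOpen_iff : ∀ s : Set X, IsOpen s ↔ ∀ x ∈ s, ∃ δ > 0, ∀ y, d x y < δ → y ∈ s

/-- `d`, `ε`, `c` are a metric on `𝒥` (inducing its topology), a radius `ε > 0` and a factor `c > 1`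
such that `σ̃` multiplies distances smaller than `ε` by `c`, and maps the open ball `B(z, α)` onto
`B(σ̃(z), c α)` for all `α ≤ ε`. -/
structure SelfSimilarAction.IsExpandingMetric {V : Type u} {Edge : Type v}
    {E : DirectedGraph V Edge} [Groupoid.{w} V] [Finite V] (A : SelfSimilarAction E)
    (d : A.LimitSpace → A.LimitSpace → ℝ) (ε c : ℝ) : Prop where
  compatible : IsCompatibleMetric d
  ε_pos : 0 < ε
  one_lt : 1 < c
  expand : ∀ z z' : A.LimitSpace, d z z' < ε → d (A.shiftLimit z) (A.shiftLimit z') = c * d z z'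
  image_ball : ∀ (z : A.LimitSpace) (α : ℝ), α ≤ ε →
    A.shiftLimit '' {z' | d z z' < α} = {z' | d (A.shiftLimit z) z' < c * α}

/-- `(X, d, φ, ε, lam)` is a Smale space with bracket `[x, y] = br x y`. Only the values of `br` on
the pairs with `d x y ≤ ε`, where the bracket is defined, are used. -/
structure IsSmaleSpace {X : Type*} [TopologicalSpace X] (d : X → X → ℝ) (φ : X ≃ₜ X)
    (ε lam : ℝ) (br : X → X → X) : Prop where
  compact : CompactSpace X
  metric : IsCompatibleMetric d
  ε_pos : 0 < ε
  lam_pos : 0 < lam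
  lam_lt_one : lam < 1
  continuousOn : ContinuousOn (fun p : X × X => br p.1 p.2) {p | d p.1 p.2 ≤ ε}
  b1 : ∀ x, br x x = x
  b2 : ∀ x y z, d y z ≤ ε → d x (br y z) ≤ ε → d x z ≤ ε → br x (br y z) = br x z
  b3 : ∀ x y z, d x y ≤ ε → d (br x y) z ≤ ε → d x z ≤ ε → br (br x y) z = br x z
  b4 : ∀ x y, d x y ≤ ε → d (φ x) (φ y) ≤ ε → φ (br x y) = br (φ x) (φ y)
  c1 : ∀ x y, d x y ≤ ε → br x y = y → d (φ x) (φ y) ≤ lam * d x y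
  c2 : ∀ x y, d x y ≤ ε → br x y = x → d (φ.symm x) (φ.symm y) ≤ lam * d x y

/-- The local stable set `X^s(x, δ)`. -/
def localStableSet {X : Type*} (d : X → X → ℝ) (br : X → X → X) (x : X) (δ : ℝ) : Set X :=
  {y | d x y < δ ∧ br y x = x}

/-- The global stable class `X^s(x)`. -/
def stableClass {X : Type*} [TopologicalSpace X] (d : X → X → ℝ) (φ : X ≃ₜ X) (x : X) : Set X :=
  {y | Tendsto (fun n : ℕ => d (φ^[n] x) (φ^[n] y)) atTop (𝓝 0)}

/-- The topology of `X^s(x)` generated by the local stable sets `X^s(y, δ)`, where `y ∈ X^s(x)` and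
`0 < δ < ε`. -/
abbrev stableTopology {X : Type*} [TopologicalSpace X] (d : X → X → ℝ) (φ : X ≃ₜ X)
    (ε : ℝ) (br : X → X → X) (x : X) : TopologicalSpace (stableClass d φ x) :=
  TopologicalSpace.generateFrom
    {U | ∃ y ∈ stableClass d φ x, ∃ δ : ℝ, 0 < δ ∧ δ < ε ∧
      U = Subtype.val ⁻¹' localStableSet d br y δ}

/-- The stable sets are totally disconnected: the local ones as subspaces of `X`, and the global
ones in their own topology. -/
def HasTotallyDisconnectedStableSets {X : Type*} [TopologicalSpace X] (d : X → X → ℝ)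
    (φ : X ≃ₜ X) (ε : ℝ) (br : X → X → X) : Prop :=
  (∀ (x : X) (δ : ℝ), 0 < δ → δ ≤ ε → IsTotallyDisconnected (localStableSet d br x δ)) ∧
  ∀ x : X, @TotallyDisconnectedSpace (stableClass d φ x) (stableTopology d φ ε br x)

/-- For all non-empty open `U`, `W` there is `N` with `φ^N(U) ∩ W ≠ ∅`. -/
def IsIrreducibleHomeo {X : Type*} [TopologicalSpace X] (φ : X ≃ₜ X) : Prop :=
  ∀ U W : Set X, IsOpen U → IsOpen W → U.Nonempty → W.Nonempty →
    ∃ N : ℕ, (φ^[N] '' U ∩ W).Nonempty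

/-- For all non-empty open `U`, `W` there is `N` with `φ^n(U) ∩ W ≠ ∅` for all `n ≥ N`. -/
def IsMixingHomeo {X : Type*} [TopologicalSpace X] (φ : X ≃ₜ X) : Prop :=
  ∀ U W : Set X, IsOpen U → IsOpen W → U.Nonempty → W.Nonempty →
    ∃ N : ℕ, ∀ n : ℕ, N ≤ n → (φ^[n] '' U ∩ W).Nonempty

/-!
Contraction gives a finite set `N ⊆ G`, a nucleus, which contains the units, is closed under
inverses and restrictions, and contains all restrictions of any given `g` to long paths. For
`n ≥ 0` relate `x` and `y` in `E^{-∞}` if some element of `N` maps `x₋ₙ … x₋₁` to `y₋ₙ … y₋₁`.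
The intersection of these relations is asymptotic equivalence, and they are transitive up to a
bounded loss in `n`, so that the chain metric of `q ^ n` for `q` close to `1` is comparable to
`q ^ n` and descends to `𝒥`.
By regularity, an element of `N` relating `σ x` to `σ y` at a large level also
relates `x` to `y` at the next level as soon as `x` and `y` are related at a fixed level; hence
`σ̃` multiplies small distances by exactly `1 / q`.

The solenoid is the inverse limit of `⋯ → 𝒥 → 𝒥`, all maps being `σ̃`, and `τ̃` is the homeomorphism
induced by `σ̃`. The bracket `[s, t]` agrees with `s` in the zeroth copy of `𝒥`, and its higher
coordinates are obtained by lifting along `t` with the local inverses of the expanding map `σ̃`.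
Local stable sets lie in fibres of the projection to the zeroth copy, and these are totally
disconnected since the fibres of `σ̃` are uniformly discrete.

Irreducibility and mixing hold since two bi-infinite paths can be spliced along any finite path
joining the past of one to the future of the other.
-/

/-- König's lemma for the tree of lists over a finite alphabet. -/
theorem exists_forall_range_map_of_forall_exists_length {α : Type*} [Finite α]
    {P : List α → Prop} (hP : ∀ μ a, P (μ ++ [a]) → P μ)
    (hlong : ∀ n : ℕ, ∃ μ, n ≤ μ.length ∧ P μ) :
    ∃ y : ℕ → α, ∀ k, P ((List.range k).map y) := by
  let Q : List α → Prop := fun μ => ∀ n : ℕ, ∃ ν, n ≤ ν.length ∧ P (μ ++ ν)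
  have extend : ∀ μ : {μ // Q μ}, ∃ a, Q (μ.1 ++ [a]) := by
    rintro ⟨μ, hμ⟩
    by_contra! hdead
    simp only [Q] at hdead
    push Not at hdead
    choose n hn using hdead
    obtain ⟨M, hM⟩ := (Set.finite_range n).bddAbove
    obtain ⟨ν, hν, hPν⟩ := hμ (M + 1)
    cases ν with
    | nil => simp at hν
    | cons a ν =>
      refine hn a ν ((hM ⟨a, rfl⟩).trans (by simpa using hν)) ?_
      rwa [List.append_assoc]
  choose next hnext using extend
  let branch : ℕ → {μ // Q μ} :=
    Nat.rec ⟨[], hlong⟩ fun _ (μ : {μ // Q μ}) => ⟨μ.1 ++ [next μ], hnext μ⟩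
  have branch_eq : ∀ k, (branch k).1 = (List.range k).map fun i => next (branch i) := by
    intro k
    induction k with
    | zero => rfl
    | succ k ih =>
      rw [List.range_succ, List.map_append, ← ih]
      rfl
  have of_append : ∀ ν μ, P (μ ++ ν) → P μ := by
    intro ν μ
    induction ν using List.reverseRecOn with
    | nil => exact fun h => by rwa [List.append_nil] at h
    | append_singleton ν a ih => exact fun h => ih (hP _ a (by rwa [List.append_assoc]))
  refine ⟨fun i => next (branch i), fun k => ?_⟩
  obtain ⟨ν, -, hν⟩ := (branch k).2 0
  rw [← branch_eq]
  exact of_append ν _ hν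

namespace DirectedGraph

variable {V : Type u} {Edge : Type v} {E : DirectedGraph V Edge}

theorem isPath_append_iff {v : V} {μ ν : List Edge} :
    E.IsPath v (μ ++ ν) ↔ E.IsPath v μ ∧ E.IsPath (E.source v μ) ν := by
  induction μ generalizing v with
  | nil => simp [IsPath, source]
  | cons e μ ih => simp [IsPath, source, ih, and_assoc]

theorem source_append (v : V) (μ ν : List Edge) :
    E.source v (μ ++ ν) = E.source (E.source v μ) ν := by
  induction μ generalizing v with
  | nil => rfl
  | cons e _ ih => exact ih _

theorem IsPath.range_unique {v v' : V} {μ : List Edge} (h : E.IsPath v μ) (h' : E.IsPath v' μ)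
    (hμ : μ ≠ []) : v = v' := by
  cases μ with
  | nil => exact absurd rfl hμ
  | cons e μ => exact h.1.symm.trans h'.1

theorem exists_rightPath_edge_eq {v : V} {y : ℕ → Edge}
    (h : ∀ k, E.IsPath v ((List.range k).map y)) : ∃ Y : E.RightPath, Y.edge = y := by
  refine ⟨⟨y, fun k => ?_⟩, rfl⟩
  have hk := h (k + 1 + 1)
  rw [List.range_succ, List.map_append, isPath_append_iff, List.range_succ, List.map_append,
    source_append] at hk
  exact hk.2.1.symm

end DirectedGraph

/-! ### Restrictions and the nucleus -/

namespace SelfSimilarAction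

variable {V : Type u} {Edge : Type v} {E : DirectedGraph V Edge} [Groupoid.{w} V]
  {A : SelfSimilarAction E}

/-- The unit `v` as an element of the set `G`. -/
abbrev unitElt (v : V) : GroupoidElt V := ⟨v, v, 𝟙 v⟩

/-- The inverse of an element of the set `G`. -/
abbrev invElt (g : GroupoidElt V) : GroupoidElt V := ⟨g.2.1, g.1, Groupoid.inv g.2.2⟩

theorem invElt_invElt (g : GroupoidElt V) : invElt (invElt g) = g := by
  simp [invElt]

theorem MapsTo.isPath_left {g : GroupoidElt V} {μ ν : List Edge} (h : A.MapsTo g μ ν) :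
    E.IsPath g.1 μ := h.1

theorem MapsTo.isPath_right {g : GroupoidElt V} {μ ν : List Edge} (h : A.MapsTo g μ ν) :
    E.IsPath g.2.1 ν :=
  h.inv.1

theorem MapsTo.ne_nil {g : GroupoidElt V} {μ ν : List Edge} (h : A.MapsTo g μ ν) (hμ : μ ≠ []) :
    ν ≠ [] := by
  rwa [← List.length_pos_iff, h.length_eq, List.length_pos_iff]

theorem MapsTo.unique {g : GroupoidElt V} {μ ν ν' : List Edge} (h : A.MapsTo g μ ν)
    (h' : A.MapsTo g μ ν') : ν = ν' := by
  obtain ⟨_, rfl⟩ := h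
  obtain ⟨_, rfl⟩ := h'
  rfl

theorem mapsTo_invElt_iff {g : GroupoidElt V} {μ ν : List Edge} :
    A.MapsTo (invElt g) ν μ ↔ A.MapsTo g μ ν :=
  ⟨fun h => by simpa using h.inv, MapsTo.inv⟩

variable (A) in
theorem exists_mapsTo {g : GroupoidElt V} {μ : List Edge} (h : E.IsPath g.1 μ) :
    ∃ ν, A.MapsTo g μ ν :=
  ⟨_, h, rfl⟩

open Classical in
variable (A) in
/-- The restriction `g|_μ`, extended by `g|_μ = g` to strings `μ` which are not paths in the domain
of `g`. -/
noncomputable def res (g : GroupoidElt V) (μ : List Edge) : GroupoidElt V :=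
  if h : E.IsPath g.1 μ then A.restrictElt g.2.2 ⟨μ, h⟩ else g

theorem res_of_isPath {v w : V} (g : v ⟶ w) (μ : E.PathsTo v) :
    A.res ⟨v, w, g⟩ μ.1 = A.restrictElt g μ := by
  simp [res, μ.2]

theorem res_fst {g : GroupoidElt V} {μ : List Edge} (h : E.IsPath g.1 μ) :
    (A.res g μ).1 = E.source g.1 μ := by
  rw [res, dif_pos h]; rfl

variable (A) in
theorem isPath_append_iff_res {g : GroupoidElt V} {μ ν : List Edge} :
    E.IsPath g.1 (μ ++ ν) ↔ E.IsPath g.1 μ ∧ E.IsPath (A.res g μ).1 ν := by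
  rw [isPath_append_iff]
  exact and_congr_right fun h => by rw [res_fst h]

theorem mapsTo_append {g : GroupoidElt V} {μ ν κ₁ κ₂ : List Edge} (hl : κ₁.length = μ.length) :
    A.MapsTo g (μ ++ ν) (κ₁ ++ κ₂) ↔ A.MapsTo g μ κ₁ ∧ A.MapsTo (A.res g μ) ν κ₂ := by
  obtain ⟨v, w, g⟩ := g
  constructor
  · rintro ⟨h, hh⟩
    obtain ⟨hμ, hν⟩ := isPath_append_iff.1 h
    have hlen : (A.act g ⟨μ, hμ⟩).1.length = μ.length := (A.toPartialIso g).length_map _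
    obtain ⟨e₁, e₂⟩ := List.append_inj (hh.symm.trans (A.restrict_spec g ⟨μ, hμ⟩ ⟨ν, hν⟩))
      (hl.trans hlen.symm)
    rw [res_of_isPath g ⟨μ, hμ⟩]
    exact ⟨⟨hμ, e₁.symm⟩, hν, e₂.symm⟩
  · rintro ⟨⟨hμ, rfl⟩, h⟩
    rw [res_of_isPath g ⟨μ, hμ⟩] at h
    obtain ⟨hν, rfl⟩ := h
    exact ⟨isPath_append hμ hν, A.restrict_spec g ⟨μ, hμ⟩ ⟨ν, hν⟩⟩

theorem MapsTo.exists_of_append {g : GroupoidElt V} {μ ν κ : List Edge}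
    (h : A.MapsTo g (μ ++ ν) κ) :
    ∃ κ₁ κ₂, κ = κ₁ ++ κ₂ ∧ κ₁.length = μ.length ∧ A.MapsTo g μ κ₁ ∧
      A.MapsTo (A.res g μ) ν κ₂ := by
  have hl := h.length_eq
  rw [List.length_append] at hl
  have hlen : (κ.take μ.length).length = μ.length := by
    rw [List.length_take]; omega
  rw [← List.take_append_drop μ.length κ] at h
  exact ⟨_, _, (List.take_append_drop _ _).symm, hlen, (mapsTo_append hlen).1 h⟩

variable (A) in
theorem elt_ext (hs : E.NoSources) {g h : GroupoidElt V}
    (H : ∀ μ ν, A.MapsTo g μ ν → A.MapsTo h μ ν) : g = h := by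
  obtain ⟨v, w, g⟩ := g
  obtain ⟨v', w', h⟩ := h
  obtain ⟨e, he⟩ := hs v
  obtain ⟨ν, hν⟩ := A.exists_mapsTo (g := ⟨v, w, g⟩) (μ := [e]) ⟨he, trivial⟩
  have hν' := H _ _ hν
  obtain rfl : v = v' := hν.isPath_left.range_unique hν'.isPath_left (by simp)
  obtain rfl : w = w' := hν.isPath_right.range_unique hν'.isPath_right (hν.ne_nil (by simp))
  have hequiv : (A.toPartialIso g).toEquiv = (A.toPartialIso h).toEquiv := by
    ext μ : 1
    obtain ⟨_, hact⟩ := H μ.1 _ ⟨μ.2, rfl⟩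
    exact Subtype.ext hact.symm
  have hiso : A.toPartialIso g = A.toPartialIso h := by
    generalize A.toPartialIso g = a, A.toPartialIso h = b at hequiv
    cases a; cases b; cases hequiv; rfl
  rw [A.faithful v w hiso]

theorem res_append (hs : E.NoSources) {g : GroupoidElt V} {μ ν : List Edge}
    (h : E.IsPath g.1 (μ ++ ν)) : A.res g (μ ++ ν) = A.res (A.res g μ) ν := by
  refine A.elt_ext hs fun κ κ' hκ => ?_
  obtain ⟨α, hα⟩ := A.exists_mapsTo h
  have hακ := (mapsTo_append hα.length_eq).2 ⟨hα, hκ⟩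
  obtain ⟨α₁, α₂, rfl, hl, -, hα₂⟩ := hα.exists_of_append
  rw [List.append_assoc, List.append_assoc, mapsTo_append hl, mapsTo_append hα₂.length_eq] at hακ
  exact hακ.2.2

theorem MapsTo.res_invElt (hs : E.NoSources) {g : GroupoidElt V} {μ ν : List Edge}
    (h : A.MapsTo g μ ν) : A.res (invElt g) ν = invElt (A.res g μ) := by
  refine A.elt_ext hs fun κ κ' hκ => ?_
  have hνκ : A.MapsTo (invElt g) (ν ++ κ) (μ ++ κ') :=
    (mapsTo_append h.inv.length_eq).2 ⟨h.inv, hκ⟩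
  exact ((mapsTo_append h.length_eq).1 (mapsTo_invElt_iff.1 hνκ)).2.inv

theorem res_unitElt (hs : E.NoSources) {v : V} {μ : List Edge} (h : E.IsPath v μ) :
    A.res (unitElt v) μ = unitElt (E.source v μ) := by
  symm
  refine A.elt_ext hs fun κ κ' hκ => ?_
  obtain rfl := hκ.unique (mapsTo_id hκ.1)
  exact ((mapsTo_append rfl).1 (mapsTo_id (isPath_append h hκ.1))).2

section Nucleus

variable (A) in
/-- Every element of `G` restricts into `F` on all paths of some fixed length: the property which
the finite set witnessing contraction has. -/
def IsContractingCore (F : Set (GroupoidElt V)) : Prop :=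
  ∀ g : GroupoidElt V, ∃ n : ℕ, ∀ μ, E.IsPath g.1 μ → μ.length = n → A.res g μ ∈ F

variable (A) in
/-- The set of all restrictions of elements of `F`. -/
def restrictions (F : Set (GroupoidElt V)) : Set (GroupoidElt V) :=
  {h | ∃ g ∈ F, ∃ μ, E.IsPath g.1 μ ∧ A.res g μ = h}

variable (A) in
/-- A finite subset of `G` that contains the units, is closed under inverses and restrictions, and
contains all restrictions of any given element of `G` to long enough paths. The (unique minimal)
nucleus of the literature is not needed: any such set serves. -/
structure IsNucleus (N : Set (GroupoidElt V)) : Prop where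
  finite : N.Finite
  unit_mem : ∀ v, unitElt v ∈ N
  inv_mem : ∀ g ∈ N, invElt g ∈ N
  res_mem : ∀ g ∈ N, ∀ μ, E.IsPath g.1 μ → A.res g μ ∈ N
  absorbs : ∀ g, ∃ n : ℕ, ∀ μ, E.IsPath g.1 μ → n ≤ μ.length → A.res g μ ∈ N

theorem IsContracting.exists_isContractingCore (hc : A.IsContracting) :
    ∃ F : Set (GroupoidElt V), F.Finite ∧ A.IsContractingCore F := by
  obtain ⟨F, hF, hres⟩ := hc
  refine ⟨F, hF, fun ⟨v, w, g⟩ => ?_⟩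
  obtain ⟨n, hn⟩ := hres v w g
  refine ⟨n, fun μ hμ hl => ?_⟩
  rw [res_of_isPath g ⟨μ, hμ⟩]
  exact hn _ hl

variable {F : Set (GroupoidElt V)}

theorem res_mem_restrictions (hs : E.NoSources) {g : GroupoidElt V} (hg : g ∈ A.restrictions F)
    {μ : List Edge} (hμ : E.IsPath g.1 μ) : A.res g μ ∈ A.restrictions F := by
  obtain ⟨g, hgF, ν, hν, rfl⟩ := hg
  have hνμ := A.isPath_append_iff_res.2 ⟨hν, hμ⟩
  exact ⟨g, hgF, ν ++ μ, hνμ, res_append hs hνμ⟩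

theorem IsContractingCore.exists_le_length_res_mem_restrictions (hs : E.NoSources)
    (hF : A.IsContractingCore F) (g : GroupoidElt V) :
    ∃ n : ℕ, ∀ μ, E.IsPath g.1 μ → n ≤ μ.length → A.res g μ ∈ A.restrictions F := by
  obtain ⟨n, hn⟩ := hF g
  refine ⟨n, fun μ hμ hl => ?_⟩
  rw [← List.take_append_drop n μ] at hμ ⊢
  have hpath := A.isPath_append_iff_res.1 hμ
  exact ⟨_, hn _ hpath.1 (by simpa using hl), _, hpath.2, (res_append hs hμ).symm⟩

/-- The first edge is split off before the core is used, since the length at which `g` restricts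
into `F` may be `0`, which would not shorten the path. -/
theorem IsContractingCore.exists_shorter [Finite Edge] (hs : E.NoSources) (hfin : F.Finite)
    (hF : A.IsContractingCore F) :
    ∃ M : ℕ, ∀ g ∈ F, ∀ μ, E.IsPath g.1 μ → M < μ.length →
      ∃ g' ∈ F, ∃ ν, E.IsPath g'.1 ν ∧ ν.length < μ.length ∧ A.res g' ν = A.res g μ := by
  choose n hn using hF
  obtain ⟨M, hM⟩ :=
    (hfin.image2 (fun g e => n (A.res g [e])) (Set.finite_univ (α := Edge))).bddAbove
  refine ⟨M, fun g hg μ hμ hl => ?_⟩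
  cases μ with
  | nil => simp at hl
  | cons e μ =>
    set m := n (A.res g [e])
    have hm : m ≤ μ.length := (hM ⟨g, hg, e, trivial, rfl⟩).trans (by simpa using hl)
    have hcons : E.IsPath g.1 ([e] ++ μ) := hμ
    have hsplit : E.IsPath (A.res g [e]).1 (μ.take m ++ μ.drop m) := by
      rw [List.take_append_drop]
      exact (A.isPath_append_iff_res.1 hcons).2
    obtain ⟨htake, hdrop⟩ := A.isPath_append_iff_res.1 hsplit
    refine ⟨_, hn _ (μ.take m) htake (List.length_take_of_le hm), μ.drop m, hdrop, by simp, ?_⟩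
    rw [← res_append hs hsplit, List.take_append_drop]
    exact (res_append hs hcons).symm

theorem IsContractingCore.finite_restrictions [Finite Edge] (hs : E.NoSources) (hfin : F.Finite)
    (hF : A.IsContractingCore F) : (A.restrictions F).Finite := by
  obtain ⟨M, hM⟩ := hF.exists_shorter hs hfin
  have exists_short : ∀ (L : ℕ) (g : GroupoidElt V), g ∈ F → ∀ μ, E.IsPath g.1 μ → μ.length = L →
      ∃ g' ∈ F, ∃ ν : List Edge, ν.length ≤ M ∧ A.res g' ν = A.res g μ := by
    intro L
    induction L using Nat.strong_induction_on with
    | _ L ih =>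
      rintro g hg μ hμ rfl
      rcases le_or_gt μ.length M with hl | hl
      · exact ⟨g, hg, μ, hl, rfl⟩
      · obtain ⟨g', hg', ν, hν, hlt, heq⟩ := hM g hg μ hμ hl
        obtain ⟨g'', hg'', ν', hν', heq'⟩ := ih _ hlt g' hg' ν hν rfl
        exact ⟨g'', hg'', ν', hν', heq'.trans heq⟩
  refine (hfin.image2 A.res (List.finite_length_le Edge M)).subset ?_
  rintro _ ⟨g, hg, μ, hμ, rfl⟩
  exact exists_short _ g hg μ hμ rfl

theorem exists_isNucleus [Finite V] [Finite Edge] (hs : E.NoSources) (hc : A.IsContracting) :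
    ∃ N, A.IsNucleus N := by
  obtain ⟨F, hfin, hF⟩ := hc.exists_isContractingCore
  have hR := hF.finite_restrictions hs hfin
  refine ⟨A.restrictions F ∪ invElt '' A.restrictions F ∪ Set.range unitElt,
    (hR.union (hR.image _)).union (Set.finite_range _), fun v => Or.inr ⟨v, rfl⟩, ?_, ?_,
    fun g => ?_⟩
  · rintro g ((hg | ⟨g, hg, rfl⟩) | ⟨v, rfl⟩)
    · exact Or.inl (Or.inr ⟨g, hg, rfl⟩)
    · exact Or.inl (Or.inl (by rwa [invElt_invElt]))
    · exact Or.inr ⟨v, by simp⟩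
  · rintro g ((hg | ⟨g, hg, rfl⟩) | ⟨v, rfl⟩) μ hμ
    · exact Or.inl (Or.inl (res_mem_restrictions hs hg hμ))
    · obtain ⟨ν, hν⟩ := A.exists_mapsTo hμ
      have hν' : A.MapsTo g ν μ := mapsTo_invElt_iff.1 hν
      exact Or.inl (Or.inr ⟨_, res_mem_restrictions hs hg hν'.1, (hν'.res_invElt hs).symm⟩)
    · exact Or.inr ⟨_, (res_unitElt hs hμ).symm⟩
  · obtain ⟨n, hn⟩ := hF.exists_le_length_res_mem_restrictions hs g
    exact ⟨n, fun μ hμ hl => Or.inl (Or.inl (hn μ hμ hl))⟩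

theorem IsNucleus.exists_forall_mem_absorbs {N : Set (GroupoidElt V)} (hN : A.IsNucleus N)
    {P : Set (GroupoidElt V)} (hP : P.Finite) :
    ∃ n : ℕ, ∀ g ∈ P, ∀ μ, E.IsPath g.1 μ → n ≤ μ.length → A.res g μ ∈ N := by
  choose n hn using hN.absorbs
  obtain ⟨M, hM⟩ := (hP.image n).bddAbove
  exact ⟨M, fun g hg μ hμ hl => hn g μ hμ ((hM ⟨g, hg, rfl⟩).trans hl)⟩

end Nucleus

section Regularity

theorem IsRegular.exists_res_initial_eq_unitElt (hr : A.IsRegular) {y : E.RightPath}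
    {g : GroupoidElt V} (hfix : ∀ n, A.MapsTo g (y.initial n) (y.initial n)) :
    ∃ n v, A.res g (y.initial n) = unitElt v := by
  have hdom : g.1 = y.range := (hfix 1).isPath_left.1.symm
  have hcod : g.2.1 = y.range := (hfix 1).isPath_right.1.symm
  obtain ⟨a, b, g⟩ := g
  dsimp only at hdom hcod
  subst hdom hcod
  obtain ⟨n, -, hn⟩ := hr y g fun n => Subtype.ext (hfix n).2
  exact ⟨n, _, (res_of_isPath g ⟨y.initial n, y.isPath_initial n⟩).trans hn⟩

theorem IsRegular.exists_forall_fixed_res_eq_unitElt [Finite Edge] (hs : E.NoSources)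
    (hr : A.IsRegular) (g : GroupoidElt V) :
    ∃ k : ℕ, ∀ μ, k ≤ μ.length → A.MapsTo g μ μ → ∃ v, A.res g μ = unitElt v := by
  by_contra! hbad
  obtain ⟨y, hy⟩ := exists_forall_range_map_of_forall_exists_length
    (P := fun μ => A.MapsTo g μ μ ∧ ∀ v, A.res g μ ≠ unitElt v)
    (fun μ e ⟨hfix, hne⟩ => ⟨hfix.of_concat, fun v hv => by
      have hμ := A.isPath_append_iff_res.1 hfix.1
      rw [hv] at hμ
      exact hne _ (by rw [res_append hs hfix.1, hv, res_unitElt hs hμ.2])⟩) hbad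
  obtain ⟨Y, rfl⟩ := exists_rightPath_edge_eq fun k => (hy k).1.1
  obtain ⟨n, v, hn⟩ := hr.exists_res_initial_eq_unitElt (y := Y) fun k => (hy k).1
  exact (hy n).2 v hn

/-- Apply the previous lemma to the elements `h⁻¹ g`, which fix `μ`. -/
theorem IsRegular.exists_forall_res_eq [Finite Edge] (hs : E.NoSources) (hr : A.IsRegular)
    {N : Set (GroupoidElt V)} (hN : N.Finite) :
    ∃ k : ℕ, ∀ g ∈ N, ∀ h ∈ N, ∀ μ ν, k ≤ μ.length → A.MapsTo g μ ν → A.MapsTo h μ ν →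
      A.res g μ = A.res h μ := by
  choose k hk using hr.exists_forall_fixed_res_eq_unitElt hs
  obtain ⟨M, hM⟩ := (hN.image2 (fun g h => k (eltMul (invElt h) g)) hN).bddAbove
  refine ⟨M + 1, fun g hg h hh μ ν hl hgμ hhμ => A.elt_ext hs fun κ κ' hκ => ?_⟩
  have hne : μ ≠ [] := by rintro rfl; simp at hl
  have hfix : A.MapsTo (eltMul (invElt h) g) μ μ := hgμ.mul hne hhμ.inv
  obtain ⟨v, hv⟩ := hk _ μ ((hM ⟨g, hg, h, hh, rfl⟩).trans (by omega)) hfix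
  have hgκ : A.MapsTo g (μ ++ κ) (ν ++ κ') := (mapsTo_append hgμ.length_eq).2 ⟨hgμ, hκ⟩
  have hfixκ : A.MapsTo (eltMul (invElt h) g) (μ ++ κ) (μ ++ κ) := by
    have hdom := hfix.isPath_left.range_unique hgμ.isPath_left hne
    have hpath := hgκ.isPath_left
    rw [← hdom, A.isPath_append_iff_res, hv] at hpath
    exact (mapsTo_append rfl).2 ⟨hfix, by rw [hv]; exact mapsTo_id hpath.2⟩
  have hcod : g.2.1 = h.2.1 :=
    hgμ.isPath_right.range_unique hhμ.isPath_right (hgμ.ne_nil hne)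
  obtain ⟨η, hη⟩ := A.exists_mapsTo (g := invElt h) (hcod ▸ hgκ.isPath_right)
  obtain rfl := hfixκ.unique (hgκ.mul (by simp [hne]) hη)
  exact ((mapsTo_append hhμ.length_eq).1 (mapsTo_invElt_iff.1 hη)).2

end Regularity

end SelfSimilarAction

/-! ### Chain metrics of expanding scales -/

/-- `d` is a pseudometric on `X`. It is a predicate on functions rather than an instance because
`X` usually carries a topology of its own, and several pseudometrics at once. -/
structure IsPseudometric {X : Type*} (d : X → X → ℝ) : Prop where
  self : ∀ x, d x x = 0
  comm : ∀ x y, d x y = d y x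
  triangle : ∀ x y z, d x z ≤ d x y + d y z

/-- At distances smaller than `ε`, the map `f` multiplies the pseudometric `d` by `c > 1`, and it
maps the balls of radius at most `ε` onto balls. This is the part of the definition of an expanding
metric which does not refer to the topology of the space. -/
structure IsLocallyScaling {X : Type*} (d : X → X → ℝ) (f : X → X) (ε c : ℝ) : Prop where
  ε_pos : 0 < ε
  one_lt : 1 < c
  expand : ∀ x y, d x y < ε → d (f x) (f y) = c * d x y
  image_ball : ∀ x α, α ≤ ε → f '' {y | d x y < α} = {y | d (f x) y < c * α}

section ChainMetric

open scoped NNReal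

variable {X : Type*} {D : X → X → ℝ≥0}

/-- `StepChain D x y t`: there is a finite chain from `x` to `y` whose steps have total
`D`-length `t`. -/
inductive StepChain (D : X → X → ℝ≥0) : X → X → ℝ≥0 → Prop
  | nil (x : X) : StepChain D x x 0
  | cons (x : X) {y z : X} {t : ℝ≥0} (h : StepChain D y z t) : StepChain D x z (D x y + t)

/-- The distance is the chain metric of `D`, that is, the largest pseudometric below `D`. -/
structure IsChainMetric [PseudoMetricSpace X] (D : X → X → ℝ≥0) : Prop where
  dist_le : ∀ x y : X, dist x y ≤ D x y
  exists_stepChain : ∀ {x y : X} {t : ℝ}, dist x y < t → ∃ s : ℝ≥0, s < t ∧ StepChain D x y s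

theorem stepChain_zipWith (D : X → X → ℝ≥0) (l : List X) (x y : X) :
    StepChain D x y (((x :: l).zipWith D (l ++ [y])).sum) := by
  induction l generalizing x with
  | nil => simpa using StepChain.cons (D := D) x (StepChain.nil y)
  | cons z l ih => exact StepChain.cons x (ih z)

theorem isChainMetric_ofPreNNDist (hself : ∀ x, D x x = 0) (hcomm : ∀ x y, D x y = D y x) :
    @IsChainMetric X (PseudoMetricSpace.ofPreNNDist D hself hcomm) D := by
  let _ := PseudoMetricSpace.ofPreNNDist D hself hcomm
  refine ⟨PseudoMetricSpace.dist_ofPreNNDist_le D hself hcomm, fun {x y t} h => ?_⟩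
  rw [PseudoMetricSpace.dist_ofPreNNDist D hself hcomm] at h
  lift t to ℝ≥0 using (NNReal.coe_nonneg _).trans h.le
  obtain ⟨l, hl⟩ := exists_lt_of_ciInf_lt (NNReal.coe_lt_coe.1 h)
  exact ⟨_, NNReal.coe_lt_coe.2 hl, stepChain_zipWith D l x y⟩

namespace IsChainMetric

variable [PseudoMetricSpace X] (hD : IsChainMetric D) {f : X → X} {q r : ℝ≥0}
include hD

theorem mul_dist_map_le (hf : ∀ x y, q * D (f x) (f y) ≤ D x y) (x y : X) :
    q * dist (f x) (f y) ≤ dist x y := by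
  refine le_of_forall_gt_imp_ge_of_dense fun t ht => ?_
  obtain ⟨s, hs, hchain⟩ := hD.exists_stepChain ht
  refine le_trans ?_ hs.le
  clear hs ht
  induction hchain with
  | nil x => simp
  | @cons x y z t _ ih =>
    have hstep : (q : ℝ) * D (f x) (f y) ≤ D x y := mod_cast hf x y
    calc (q : ℝ) * dist (f x) (f z) ≤ q * (D (f x) (f y) + dist (f y) (f z)) := by
          gcongr; exact (dist_triangle _ _ _).trans (by gcongr; exact hD.dist_le _ _)
      _ = q * D (f x) (f y) + q * dist (f y) (f z) := mul_add _ _ _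
      _ ≤ D x y + t := add_le_add hstep ih
      _ = ((D x y + t : ℝ≥0) : ℝ) := by push_cast; rfl

theorem exists_lift_of_stepChain
    (hf : ∀ x u, D (f x) u ≤ r → ∃ y, f y = u ∧ D x y ≤ q * D (f x) u) {u w : X} {t : ℝ≥0}
    (h : StepChain D u w t) (ht : t ≤ r) {x : X} (hx : f x = u) :
    ∃ y, f y = w ∧ dist x y ≤ q * t := by
  induction h generalizing x with
  | nil u => exact ⟨x, hx, by simp⟩
  | @cons u v w t _ ih =>
    subst hx
    obtain ⟨y, rfl, hxy⟩ := hf x v (le_self_add.trans ht)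
    obtain ⟨z, rfl, hyz⟩ := ih (le_add_self.trans ht) rfl
    have hxy' : (D x y : ℝ) ≤ q * D (f x) (f y) := mod_cast hxy
    refine ⟨z, rfl, (dist_triangle x y z).trans ?_⟩
    push_cast
    linarith [hD.dist_le x y, hxy']

theorem exists_lift_dist_lt (hq : 0 < q)
    (hf : ∀ x u, D (f x) u ≤ r → ∃ y, f y = u ∧ D x y ≤ q * D (f x) u) {α : ℝ} (hα : α ≤ q * r)
    {x w : X} (h : q * dist (f x) w < α) : ∃ y, f y = w ∧ dist x y < α := by
  have hq' : (0 : ℝ) < q := hq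
  obtain ⟨s, hs, hchain⟩ := hD.exists_stepChain ((lt_div_iff₀' hq').2 h)
  rw [lt_div_iff₀' hq'] at hs
  have hsr : (s : ℝ) ≤ r := le_of_mul_le_mul_left (hs.le.trans hα) hq'
  obtain ⟨y, hy, hxy⟩ := hD.exists_lift_of_stepChain hf hchain (mod_cast hsr) rfl
  exact ⟨y, hy, hxy.trans_lt hs⟩

end IsChainMetric

end ChainMetric

section Scale

open scoped NNReal

variable {X : Type*} {R : ℕ → X → X → Prop} {σ : X → X} {m k : ℕ} {q : ℝ≥0}

/-- A decreasing sequence of reflexive and symmetric relations which is transitive up to a loss of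
`m` in the index; `R n x y` is to be read as closeness of `x` and `y` at scale `n`. -/
structure IsScale (R : ℕ → X → X → Prop) (m : ℕ) : Prop where
  zero : ∀ x y, R 0 x y
  anti : ∀ {n x y}, R (n + 1) x y → R n x y
  refl : ∀ n x, R n x x
  symm : ∀ {n x y}, R n x y → R n y x
  trans : ∀ {n x₁ x₂ x₃ x₄}, R (n + m) x₁ x₂ → R (n + m) x₂ x₃ → R (n + m) x₃ x₄ → R n x₁ x₄

/-- The map `σ` raises every scale by exactly one on pairs which are `(k + 1)`-close, and points
which are `(k + 1)`-close to `σ x` lift to points which are `(k + 1)`-close to `x`. -/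
structure IsExpandingScale (σ : X → X) (R : ℕ → X → X → Prop) (m k : ℕ) : Prop
    extends IsScale R m where
  map : ∀ {n x y}, R (n + 1) x y → R n (σ x) (σ y)
  succ : ∀ {n x y}, R (k + 1) x y → R n (σ x) (σ y) → R (n + 1) x y
  lift : ∀ {x u}, R (k + 1) (σ x) u → ∃ y, σ y = u ∧ R (k + 1) x y

open Classical in
/-- `q ^ n` for the largest `n` such that `R n x y`, and `0` if `R n x y` for all `n`. -/
noncomputable def scaleDist (R : ℕ → X → X → Prop) (q : ℝ≥0) (x y : X) : ℝ≥0 :=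
  if h : ∃ n, ¬ R (n + 1) x y then q ^ Nat.find h else 0

theorem scaleDist_eq_zero_or_pow (x y : X) :
    scaleDist R q x y = 0 ∨ ∃ n : ℕ, scaleDist R q x y = q ^ n := by
  unfold scaleDist
  split_ifs
  · exact Or.inr ⟨_, rfl⟩
  · exact Or.inl rfl

theorem le_mul_of_forall_le_pow (hq1 : q < 1) {a b r : ℝ≥0} (hb : b = 0 ∨ ∃ n : ℕ, b = q ^ n)
    (h : ∀ n : ℕ, b ≤ q ^ n → a ≤ r * q ^ n) : a ≤ r * b := by
  rcases hb with rfl | ⟨n, rfl⟩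
  · have ht : Tendsto (fun n : ℕ => r * q ^ n) atTop (𝓝 (r * 0)) :=
      (NNReal.tendsto_pow_atTop_nhds_zero_of_lt_one hq1).const_mul r
    exact ge_of_tendsto' ht fun n => h n zero_le
  · exact h n le_rfl

/-- The condition `1 ≤ 2 q ^ m` makes up for the loss of `m` in transitivity: it turns it into the
quasi-triangle inequality with constant `2` under which chain metrics do not degenerate. -/
theorem exists_ratio (m : ℕ) : ∃ q : ℝ≥0, 0 < q ∧ q < 1 ∧ 1 ≤ 2 * q ^ m := by
  have hcont : ContinuousAt (fun q : ℝ => 2 * q ^ m) 1 := by fun_prop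
  have hnear : ∀ᶠ q : ℝ in 𝓝[<] 1, 0 < q ∧ q < 1 ∧ 1 < 2 * q ^ m := by
    filter_upwards [nhdsWithin_le_nhds (lt_mem_nhds one_pos), self_mem_nhdsWithin,
      nhdsWithin_le_nhds (hcont.eventually (lt_mem_nhds (a := 1) (by simp)))] with q h₀ h₁ h₂
    exact ⟨h₀, h₁, h₂⟩
  obtain ⟨q, h₀, h₁, h₂⟩ := hnear.exists
  lift q to ℝ≥0 using h₀.le
  exact ⟨q, mod_cast h₀, mod_cast h₁, mod_cast h₂.le⟩

theorem IsScale.mono (h : IsScale R m) {a b : ℕ} (hab : a ≤ b) {x y : X} (hR : R b x y) :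
    R a x y :=
  antitone_nat_of_succ_le (f := fun n => R n x y) (fun _ => h.anti) hab hR

theorem IsScale.scaleDist_le_pow_iff (h : IsScale R m) (hq : 0 < q) (hq1 : q < 1) {x y : X}
    {n : ℕ} : scaleDist R q x y ≤ q ^ n ↔ R n x y := by
  classical
  unfold scaleDist
  split_ifs with hex
  · rw [pow_le_pow_iff_right_of_lt_one₀ hq hq1]
    refine ⟨fun hn => ?_, fun hR => not_lt.1 fun hn => Nat.find_spec hex (h.mono hn hR)⟩
    cases n with
    | zero => exact h.zero x y
    | succ n => exact not_not.1 (Nat.find_min hex hn)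
  · push Not at hex
    refine ⟨fun _ => ?_, fun _ => zero_le⟩
    cases n with
    | zero => exact h.zero x y
    | succ n => exact hex n

theorem IsScale.le_mul_scaleDist (h : IsScale R m) (hq : 0 < q) (hq1 : q < 1) {x y : X}
    {a r : ℝ≥0} (ha : ∀ n, R n x y → a ≤ r * q ^ n) : a ≤ r * scaleDist R q x y :=
  le_mul_of_forall_le_pow hq1 (scaleDist_eq_zero_or_pow x y) fun n hn =>
    ha n ((h.scaleDist_le_pow_iff hq hq1).1 hn)

theorem IsScale.scaleDist_eq_zero_iff (h : IsScale R m) (hq : 0 < q) (hq1 : q < 1) {x y : X} :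
    scaleDist R q x y = 0 ↔ ∀ n, R n x y := by
  refine ⟨fun h₀ n => (h.scaleDist_le_pow_iff hq hq1).1 (h₀ ▸ zero_le), fun hR => ?_⟩
  simp [scaleDist, hR]

theorem IsScale.scaleDist_self (h : IsScale R m) (x : X) : scaleDist R q x x = 0 := by
  simp [scaleDist, h.refl]

theorem IsScale.scaleDist_comm (h : IsScale R m) (x y : X) :
    scaleDist R q x y = scaleDist R q y x := by
  have hiff : ∀ n, R n x y ↔ R n y x := fun n => ⟨h.symm, h.symm⟩
  unfold scaleDist
  congr! 3 <;> simp only [hiff]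

theorem IsScale.scaleDist_le_two_mul_max (h : IsScale R m) (hq : 0 < q) (hq1 : q < 1)
    (hqm : 1 ≤ 2 * q ^ m) (x₁ x₂ x₃ x₄ : X) :
    scaleDist R q x₁ x₄ ≤
      2 * max (scaleDist R q x₁ x₂) (max (scaleDist R q x₂ x₃) (scaleDist R q x₃ x₄)) := by
  refine le_mul_of_forall_le_pow hq1 (max_rec' (fun b => b = 0 ∨ ∃ n : ℕ, b = q ^ n)
    (scaleDist_eq_zero_or_pow _ _) (max_rec' (fun b => b = 0 ∨ ∃ n : ℕ, b = q ^ n)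
      (scaleDist_eq_zero_or_pow _ _) (scaleDist_eq_zero_or_pow _ _))) fun n hn => ?_
  simp only [max_le_iff, h.scaleDist_le_pow_iff hq hq1] at hn
  obtain ⟨h₁₂, h₂₃, h₃₄⟩ := hn
  rcases le_total m n with hmn | hnm
  · obtain ⟨j, rfl⟩ := Nat.exists_eq_add_of_le' hmn
    calc scaleDist R q x₁ x₄ ≤ q ^ j := (h.scaleDist_le_pow_iff hq hq1).2 (h.trans h₁₂ h₂₃ h₃₄)
      _ ≤ 2 * q ^ m * q ^ j := le_mul_of_one_le_left zero_le hqm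
      _ = 2 * q ^ (j + m) := by rw [pow_add]; ring
  · calc scaleDist R q x₁ x₄ ≤ q ^ 0 := (h.scaleDist_le_pow_iff hq hq1).2 (h.zero _ _)
      _ ≤ 2 * q ^ m := by rwa [pow_zero]
      _ ≤ 2 * q ^ n := by gcongr 2 * ?_; exact pow_le_pow_of_le_one zero_le hq1.le hnm

theorem IsExpandingScale.mul_scaleDist_map_le (h : IsExpandingScale σ R m k) (hq : 0 < q)
    (hq1 : q < 1) (x y : X) : q * scaleDist R q (σ x) (σ y) ≤ scaleDist R q x y := by
  rw [← one_mul (scaleDist R q x y)]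
  refine h.le_mul_scaleDist hq hq1 fun n hn => ?_
  rw [one_mul]
  cases n with
  | zero =>
    exact mul_le_one₀ hq1.le zero_le
      ((h.scaleDist_le_pow_iff hq hq1 (n := 0)).2 (h.zero _ _))
  | succ n =>
    rw [pow_succ']
    gcongr
    exact (h.scaleDist_le_pow_iff hq hq1).2 (h.map hn)

theorem IsExpandingScale.exists_lift_scaleDist_le (h : IsExpandingScale σ R m k) (hq : 0 < q)
    (hq1 : q < 1) (x u : X) (hu : scaleDist R q (σ x) u ≤ q ^ (k + 1)) :
    ∃ y, σ y = u ∧ scaleDist R q x y ≤ q * scaleDist R q (σ x) u := by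
  obtain ⟨y, rfl, hy⟩ := h.lift ((h.scaleDist_le_pow_iff hq hq1).1 hu)
  refine ⟨y, rfl, h.le_mul_scaleDist hq hq1 fun n hn => ?_⟩
  rw [← pow_succ']
  exact (h.scaleDist_le_pow_iff hq hq1).2 (h.succ hy hn)

theorem IsExpandingScale.scaleDist_eq_zero_of_map_eq (h : IsExpandingScale σ R m k) (hq : 0 < q)
    (hq1 : q < 1) {x y : X} (hσ : σ x = σ y) (hxy : scaleDist R q x y ≤ q ^ (k + 1)) :
    scaleDist R q x y = 0 :=
  (h.scaleDist_eq_zero_iff hq hq1).2 fun n =>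
    h.anti (h.succ ((h.scaleDist_le_pow_iff hq hq1).1 hxy) (hσ ▸ h.refl n _))

/-- The radius is `q ^ (k + 1) * q / 4`: the factor `q` makes chains of length less than `ε / q`
liftable, and the factor `1 / 4` makes two such lifts of the same point coincide. -/
theorem IsExpandingScale.isLocallyScaling_dist [PseudoMetricSpace X]
    (h : IsExpandingScale σ R m k) (hq : 0 < q) (hq1 : q < 1) (hD : IsChainMetric (scaleDist R q))
    (htwo : ∀ x y, (scaleDist R q x y : ℝ) ≤ 2 * dist x y) :
    IsLocallyScaling (dist : X → X → ℝ) σ (q * q ^ (k + 1) / 4) (q : ℝ)⁻¹ := by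
  have hq' : (0 : ℝ) < q := hq
  have hq1' : (q : ℝ) < 1 := hq1
  have hpow : (0 : ℝ) < q ^ (k + 1) := by positivity
  have hmap := hD.mul_dist_map_le (h.mul_scaleDist_map_le hq hq1)
  have hlift : ∀ {α : ℝ}, α ≤ q * q ^ (k + 1) / 4 → ∀ {x w : X}, q * dist (σ x) w < α →
      ∃ y, σ y = w ∧ dist x y < α := fun hα _ _ hw =>
    hD.exists_lift_dist_lt hq (h.exists_lift_scaleDist_le hq hq1)
      (hα.trans (by push_cast; nlinarith [mul_pos hq' hpow])) hw
  refine ⟨by positivity, (one_lt_inv₀ hq').2 hq1', fun x y hxy => ?_, fun x α hα => ?_⟩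
  · rw [eq_inv_mul_iff_mul_eq₀ hq'.ne']
    refine (hmap x y).antisymm (not_lt.1 fun hlt => ?_)
    obtain ⟨y', hσ, hy'⟩ := hlift hxy.le hlt
    have hsmall : (scaleDist R q y' y : ℝ) ≤ q ^ (k + 1) := by
      nlinarith [htwo y' y, dist_triangle_left y' y x]
    have hzero : dist y' y ≤ 0 := by
      simpa [h.scaleDist_eq_zero_of_map_eq hq hq1 hσ (mod_cast hsmall)] using hD.dist_le y' y
    linarith [dist_triangle x y' y]
  · ext w
    simp only [Set.mem_image, Set.mem_ofPred_eq, lt_inv_mul_iff₀ hq']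
    refine ⟨?_, fun hw => ?_⟩
    · rintro ⟨y, hy, rfl⟩
      exact (hmap x y).trans_lt hy
    · obtain ⟨y, hσ, hy⟩ := hlift hα hw
      exact ⟨y, hy, hσ⟩

theorem IsExpandingScale.exists_isLocallyScaling (h : IsExpandingScale σ R m k) :
    ∃ (d : X → X → ℝ) (ε c : ℝ), IsPseudometric d ∧ (∀ x y, d x y = 0 ↔ ∀ n, R n x y) ∧
      (∀ δ > 0, ∃ n, ∀ x y, R n x y → d x y < δ) ∧ IsLocallyScaling d σ ε c := by
  obtain ⟨q, hq, hq1, hqm⟩ := exists_ratio m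
  have hself := h.scaleDist_self (q := q)
  have hcomm := h.scaleDist_comm (q := q)
  let _ : PseudoMetricSpace X := PseudoMetricSpace.ofPreNNDist (scaleDist R q) hself hcomm
  have hD : IsChainMetric (scaleDist R q) := isChainMetric_ofPreNNDist hself hcomm
  have htwo : ∀ x y, (scaleDist R q x y : ℝ) ≤ 2 * dist x y :=
    PseudoMetricSpace.le_two_mul_dist_ofPreNNDist _ hself hcomm
      (h.scaleDist_le_two_mul_max hq hq1 hqm)
  refine ⟨dist, _, _, ⟨dist_self, dist_comm, dist_triangle⟩, fun x y => ?_, fun δ hδ => ?_,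
    h.isLocallyScaling_dist hq hq1 hD htwo⟩
  · rw [← h.scaleDist_eq_zero_iff hq hq1]
    refine ⟨fun h₀ => ?_, fun h₀ => ?_⟩
    · exact le_antisymm (mod_cast (htwo x y).trans (by simp [h₀])) zero_le
    · exact le_antisymm (by simpa [h₀] using hD.dist_le x y) dist_nonneg
  · obtain ⟨n, hn⟩ := exists_pow_lt_of_lt_one hδ (show (q : ℝ) < 1 from hq1)
    refine ⟨n, fun x y hR => (hD.dist_le x y).trans_lt (lt_of_le_of_lt ?_ hn)⟩
    exact_mod_cast (h.scaleDist_le_pow_iff hq hq1).2 hR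

end Scale

/-! ### The scale of a nucleus -/

namespace DirectedGraph.LeftPath

variable {V : Type u} {Edge : Type v} {E : DirectedGraph V Edge} (x : E.LeftPath)

@[simp]
theorem length_final (n : ℕ) : (x.final n).length = n := by
  simp [final]

theorem exists_final_add_eq (n m : ℕ) :
    ∃ μ : List Edge, μ.length = m ∧ x.final (n + m) = μ ++ x.final n := by
  refine ⟨(List.range m).reverse.map fun i => x.edge (n + i), by simp, ?_⟩
  simp [final, List.range_add, List.map_reverse, Function.comp_def]

theorem exists_isPath_final (n : ℕ) : ∃ v, E.IsPath v (x.final n) := by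
  cases n with
  | zero => exact ⟨E.r (x.edge 0), by simp [final, IsPath]⟩
  | succ n => exact ⟨_, x.isPath_final n⟩

theorem source_final (v : V) (n : ℕ) : E.source v (x.final (n + 1)) = E.s (x.edge 0) := by
  rw [final_shift, source_append]
  rfl

/-- The left-infinite path `x e`. -/
def snoc (e : Edge) (h : E.s (x.edge 0) = E.r e) : E.LeftPath where
  edge
    | 0 => e
    | k + 1 => x.edge k
  chain
    | 0 => h
    | k + 1 => x.chain k

end DirectedGraph.LeftPath

namespace SelfSimilarAction

variable {V : Type u} {Edge : Type v} {E : DirectedGraph V Edge} [Groupoid.{w} V]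
  {A : SelfSimilarAction E} {N : Set (GroupoidElt V)} {x y : E.LeftPath} {n m : ℕ}

variable (A) in
/-- Some element of `N` maps `x₋ₙ … x₋₁` to `y₋ₙ … y₋₁`. For a nucleus `N` these relations are an
expanding scale whose intersection is asymptotic equivalence. -/
def NucRel (N : Set (GroupoidElt V)) (n : ℕ) (x y : E.LeftPath) : Prop :=
  ∃ g ∈ N, A.MapsTo g (x.final n) (y.final n)

theorem MapsTo.exists_res_mapsTo_final {g : GroupoidElt V}
    (h : A.MapsTo g (x.final (n + m)) (y.final (n + m))) :
    ∃ μ, E.IsPath g.1 μ ∧ μ.length = m ∧ A.MapsTo (A.res g μ) (x.final n) (y.final n) := by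
  obtain ⟨μ, hμ, hx⟩ := x.exists_final_add_eq n m
  obtain ⟨ν, hν, hy⟩ := y.exists_final_add_eq n m
  rw [hx, hy, mapsTo_append (hν.trans hμ.symm)] at h
  exact ⟨μ, h.1.isPath_left, hμ, h.2⟩

theorem NucRel.shift (h : A.NucRel N (n + 1) x y) : A.NucRel N n x.shift y.shift := by
  obtain ⟨g, hg, h⟩ := h
  rw [LeftPath.final_shift, LeftPath.final_shift y] at h
  exact ⟨g, hg, h.of_concat⟩

theorem NucRel.exists_lift {u : E.LeftPath} (h : A.NucRel N (n + 1) x.shift u) :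
    ∃ y : E.LeftPath, y.shift = u ∧ A.NucRel N (n + 2) x y := by
  obtain ⟨g, hg, h⟩ := h
  have hpath : E.IsPath g.1 (x.shift.final (n + 1) ++ [x.edge 0]) := by
    refine isPath_append h.isPath_left ?_
    rw [LeftPath.source_final]
    exact ⟨(x.chain 0).symm, trivial⟩
  obtain ⟨κ, hκ⟩ := A.exists_mapsTo hpath
  obtain ⟨κ₁, κ₂, rfl, -, hκ₁, hκ₂⟩ := hκ.exists_of_append
  obtain rfl := h.unique hκ₁
  obtain ⟨f, rfl⟩ := List.length_eq_one_iff.1 hκ₂.length_eq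
  have hf := (isPath_append_iff.1 hκ.isPath_right).2
  rw [LeftPath.source_final] at hf
  refine ⟨u.snoc f hf.1.symm, rfl, g, hg, ?_⟩
  rw [LeftPath.final_shift, LeftPath.final_shift (u.snoc f _)]
  exact hκ

namespace IsNucleus

variable (hN : A.IsNucleus N)
include hN

theorem nucRel_anti (hnm : n ≤ m) (h : A.NucRel N m x y) : A.NucRel N n x y := by
  obtain ⟨k, rfl⟩ := Nat.exists_eq_add_of_le hnm
  obtain ⟨g, hg, h⟩ := h
  obtain ⟨μ, hμ, -, h⟩ := h.exists_res_mapsTo_final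
  exact ⟨_, hN.res_mem g hg μ hμ, h⟩

theorem nucRel_of_final_eq (h : x.final n = y.final n) : A.NucRel N n x y := by
  obtain ⟨v, hv⟩ := x.exists_isPath_final n
  exact ⟨_, hN.unit_mem v, h ▸ mapsTo_id hv⟩

theorem nucRel_symm (h : A.NucRel N n x y) : A.NucRel N n y x := by
  obtain ⟨g, hg, h⟩ := h
  exact ⟨_, hN.inv_mem g hg, h.inv⟩

theorem leftAsymp_iff : A.LeftAsymp x y ↔ ∀ n, A.NucRel N n x y := by
  constructor
  · rintro ⟨g, hg, h⟩ n
    obtain ⟨m, hm⟩ := hN.exists_forall_mem_absorbs hg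
    have hnm := h (n + m)
    rw [Nat.add_right_comm] at hnm
    obtain ⟨μ, hμ, hlen, hres⟩ := hnm.exists_res_mapsTo_final
    exact hN.nucRel_anti n.le_succ ⟨_, hm _ ⟨_, rfl⟩ μ hμ hlen.ge, hres⟩
  · intro h
    choose g hg h using h
    exact ⟨fun n => g (n + 1), hN.finite.subset (Set.range_subset_iff.2 fun n => hg _),
      fun n => h (n + 1)⟩

/-- Products of three elements of `N` restrict into `N` on all long enough paths. -/
theorem exists_isScale_nucRel : ∃ m, IsScale (A.NucRel N) m := by
  obtain ⟨m, hm⟩ := hN.exists_forall_mem_absorbs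
    (hN.finite.image2 eltMul (hN.finite.image2 eltMul hN.finite))
  have hzero : ∀ x y, A.NucRel N 0 x y := fun x y => hN.nucRel_of_final_eq rfl
  refine ⟨m, hzero, fun h => hN.nucRel_anti (Nat.le_succ _) h,
    fun n x => hN.nucRel_of_final_eq rfl, hN.nucRel_symm, fun {n x₁ x₂ x₃ x₄} h₁ h₂ h₃ => ?_⟩
  rcases n.eq_zero_or_pos with rfl | hn
  · exact hzero _ _
  obtain ⟨g₁, hg₁, h₁⟩ := h₁
  obtain ⟨g₂, hg₂, h₂⟩ := h₂
  obtain ⟨g₃, hg₃, h₃⟩ := h₃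
  have hne : x₁.final (n + m) ≠ [] := by
    rw [← List.length_pos_iff, LeftPath.length_final]
    exact Nat.add_pos_left hn m
  obtain ⟨μ, hμ, hlen, hres⟩ := (MapsTo.mul hne (MapsTo.mul hne h₁ h₂) h₃).exists_res_mapsTo_final
  exact ⟨_, hm _ ⟨g₃, hg₃, _, ⟨g₂, hg₂, g₁, hg₁, rfl⟩, rfl⟩ μ hμ hlen.ge, hres⟩

/-- By regularity, a restriction of an element of `N` to a long path is determined by the images of
this path. Hence the element relating `σ x` to `σ y` acts on the last edge of `x` in the same way as
the one relating `x` to `y` at the fixed level `k + 1`. -/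
theorem exists_forall_nucRel_succ [Finite Edge] (hs : E.NoSources) (hr : A.IsRegular) :
    ∃ k : ℕ, ∀ x y : E.LeftPath, A.NucRel N (k + 1) x y → ∀ n : ℕ,
      A.NucRel N n x.shift y.shift → A.NucRel N (n + 1) x y := by
  obtain ⟨k, hk⟩ := hr.exists_forall_res_eq hs hN.finite
  refine ⟨k, fun x y hxy n h => ?_⟩
  rcases le_total n k with hnk | hkn
  · exact hN.nucRel_anti (Nat.succ_le_succ hnk) hxy
  obtain ⟨m, rfl⟩ := Nat.exists_eq_add_of_le hkn
  obtain ⟨h₀, hh₀, hxy⟩ := hxy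
  obtain ⟨g, hg, hshift⟩ := h
  refine ⟨g, hg, ?_⟩
  obtain ⟨μ, hμ, hx⟩ := x.shift.exists_final_add_eq k m
  obtain ⟨ν, hν, hy⟩ := y.shift.exists_final_add_eq k m
  have hνμ : ν.length = μ.length := hν.trans hμ.symm
  have hk_length : (y.shift.final k).length = (x.shift.final k).length := by simp
  rw [LeftPath.final_shift, LeftPath.final_shift y, mapsTo_append hk_length] at hxy
  rw [hx, hy, mapsTo_append hνμ] at hshift
  obtain ⟨hμν, hres⟩ := hshift
  have hlast : A.res (A.res g μ) (x.shift.final k) = A.res h₀ (x.shift.final k) :=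
    hk _ (hN.res_mem g hg μ hμν.isPath_left) h₀ hh₀ _ _ (by simp) hres hxy.1
  rw [LeftPath.final_shift, LeftPath.final_shift y, hx, hy, List.append_assoc, List.append_assoc,
    mapsTo_append hνμ, mapsTo_append hk_length, hlast]
  exact ⟨hμν, hres, hxy.2⟩

theorem exists_isExpandingScale_nucRel [Finite Edge] (hs : E.NoSources) (hr : A.IsRegular) :
    ∃ m k, IsExpandingScale LeftPath.shift (A.NucRel N) m k := by
  obtain ⟨m, hm⟩ := hN.exists_isScale_nucRel
  obtain ⟨k, hk⟩ := hN.exists_forall_nucRel_succ hs hr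
  refine ⟨m, k, hm, NucRel.shift, fun h hσ => hk _ _ h _ hσ, fun h => ?_⟩
  obtain ⟨y, hy, hxy⟩ := h.exists_lift
  exact ⟨y, hy, hN.nucRel_anti (Nat.le_succ _) hxy⟩

end IsNucleus

end SelfSimilarAction

/-! ### The limit space and its expanding metrics -/

section Metric

variable {X Y : Type*} {d : Y → Y → ℝ}

theorem IsPseudometric.congr (hd : IsPseudometric d) {x x' y y' : Y} (hx : d x x' = 0)
    (hy : d y y' = 0) : d x y = d x' y' := by
  apply le_antisymm
  · linarith [hd.triangle x x' y, hd.triangle x' y' y, hd.comm y y']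
  · linarith [hd.triangle x' x y', hd.triangle x y y', hd.comm x x']

theorem IsPseudometric.isOpen_ball [TopologicalSpace Y] (hd : IsPseudometric d)
    (hnear : ∀ x, ∀ δ > 0, ∀ᶠ y in 𝓝 x, d x y < δ) (x : Y) (δ : ℝ) : IsOpen {y | d x y < δ} := by
  refine isOpen_iff_mem_nhds.2 fun y (hy : d x y < δ) => ?_
  filter_upwards [hnear y (δ - d x y) (sub_pos.2 hy)] with z hz
  linarith [hd.triangle x y z]

theorem topologicalSpace_eq_of_le_of_compact_of_t2 {t t' : TopologicalSpace Y}
    (ht : @CompactSpace Y t) (ht' : @T2Space Y t') (h : t ≤ t') : t = t' :=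
  le_antisymm h <| continuous_id_iff_le.1 <|
    @Continuous.continuous_symm_of_equiv_compact_to_t2 Y Y t t' ht ht' (Equiv.refl Y)
      (continuous_id_iff_le.2 h)

theorem IsPseudometric.isCompatibleMetric [TopologicalSpace Y] [CompactSpace Y]
    (hd : IsPseudometric d) (heq : ∀ x y, d x y = 0 → x = y)
    (hnear : ∀ x, ∀ δ > 0, ∀ᶠ y in 𝓝 x, d x y < δ) : IsCompatibleMetric d := by
  refine ⟨hd.self, heq, hd.comm, hd.triangle, ?_⟩
  have hopen : ∀ s : Set Y, (∀ x ∈ s, ∃ δ > 0, ∀ y, d x y < δ → y ∈ s) → IsOpen s := fun s hs =>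
    isOpen_iff_mem_nhds.2 fun x hx =>
      let ⟨δ, hδ, hsub⟩ := hs x hx
      (hnear x δ hδ).mono hsub
  let M : MetricSpace Y :=
    { dist := d
      dist_self := hd.self
      dist_comm := hd.comm
      dist_triangle := hd.triangle
      eq_of_dist_eq_zero := heq _ _ }
  have hball : ∀ s, IsOpen[M.toUniformSpace.toTopologicalSpace] s ↔
      ∀ x ∈ s, ∃ δ > 0, ∀ y, d x y < δ → y ∈ s := fun s => by
    simp only [Metric.isOpen_iff, Set.subset_def, Metric.mem_ball']
    rfl
  have hT2 : @T2Space Y M.toUniformSpace.toTopologicalSpace := inferInstance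
  rw [topologicalSpace_eq_of_le_of_compact_of_t2 ‹_› hT2 fun s hs => hopen s ((hball s).1 hs)]
  exact hball

theorem IsPseudometric.exists_isCompatibleMetric_of_isQuotientMap [TopologicalSpace X]
    [TopologicalSpace Y] [CompactSpace X] (hd : IsPseudometric d) {q : Y → X}
    (hq : IsQuotientMap q) (hzero : ∀ x y, d x y = 0 ↔ q x = q y)
    (hnear : ∀ x, ∀ δ > 0, ∀ᶠ y in 𝓝 x, d x y < δ) :
    ∃ D : X → X → ℝ, IsCompatibleMetric D ∧ ∀ x y, D (q x) (q y) = d x y := by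
  let f := Function.surjInv hq.surjective
  have hqf : ∀ z, q (f z) = z := Function.surjInv_eq hq.surjective
  have hD : ∀ x y, d (f (q x)) (f (q y)) = d x y := fun x y =>
    hd.congr ((hzero _ _).2 (hqf _)) ((hzero _ _).2 (hqf _))
  refine ⟨fun z z' => d (f z) (f z'), IsPseudometric.isCompatibleMetric
    ⟨fun _ => hd.self _, fun _ _ => hd.comm _ _, fun _ _ _ => hd.triangle _ _ _⟩
    (fun z z' h => by rw [← hqf z, ← hqf z', (hzero _ _).1 h]) ?_, hD⟩
  refine hq.surjective.forall.2 fun x δ hδ => ?_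
  have hopen : IsOpen {z | d (f (q x)) (f z) < δ} := by
    rw [← hq.isOpen_preimage]
    simpa only [Set.preimage_ofPred_eq, hD] using hd.isOpen_ball hnear x δ
  exact hopen.mem_nhds (by simpa [hd.self] using hδ)

theorem IsLocallyScaling.of_semiconj {f : Y → Y} {g : X → X} {ε c : ℝ} {D : X → X → ℝ}
    (h : IsLocallyScaling d f ε c) {q : Y → X} (hq : Function.Surjective q)
    (hD : ∀ x y, D (q x) (q y) = d x y) (hqfg : Function.Semiconj q f g) :
    IsLocallyScaling D g ε c := by
  refine ⟨h.ε_pos, h.one_lt, hq.forall₂.2 fun x y hxy => ?_, hq.forall.2 fun x α hα => ?_⟩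
  · rw [hD] at hxy ⊢
    rw [← hqfg, ← hqfg, hD, h.expand x y hxy]
  · have hpreimage : ∀ (x : Y) (α : ℝ), q ⁻¹' {z | D (q x) z < α} = {y | d x y < α} := fun x α =>
      Set.ext fun y => by simp only [Set.mem_preimage, Set.mem_ofPred_eq, hD]
    rw [← Set.image_preimage_eq {z | D (q x) z < α} hq, hpreimage, ← Set.image_comp,
      ← hqfg.comp_eq, Set.image_comp, h.image_ball x α hα, ← hpreimage,
      Set.image_preimage_eq _ hq, hqfg]

end Metric

theorem isCompact_setOf_forall_rel {α ι κ : Type*} [TopologicalSpace α] [DiscreteTopology α]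
    [CompactSpace α] (P : α → α → Prop) (a b : κ → ι) :
    IsCompact {z : ι → α | ∀ k, P (z (a k)) (z (b k))} := by
  rw [Set.ofPred_forall]
  refine (isClosed_iInter fun k => ?_).isCompact
  have hpair : Continuous fun z : ι → α => (z (a k), z (b k)) := by fun_prop
  exact (isClosed_discrete {p : α × α | P p.1 p.2}).preimage hpair

namespace DirectedGraph

variable {V : Type u} {Edge : Type v} {E : DirectedGraph V Edge}

instance [Finite Edge] : CompactSpace E.LeftPath := by
  let _ : TopologicalSpace Edge := ⊥
  have : DiscreteTopology Edge := ⟨rfl⟩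
  refine ⟨(IsInducing.mk rfl : IsInducing fun x : E.LeftPath => x.edge).isCompact_iff.2 ?_⟩
  convert isCompact_setOf_forall_rel (fun e f => E.s e = E.r f) Nat.succ id
  exact Set.ext fun z => ⟨by rintro ⟨x, -, rfl⟩; exact x.chain, fun hz => ⟨⟨z, hz⟩, trivial, rfl⟩⟩

instance [Finite Edge] : CompactSpace E.BiPath := by
  let _ : TopologicalSpace Edge := ⊥
  have : DiscreteTopology Edge := ⟨rfl⟩
  refine ⟨(IsInducing.mk rfl : IsInducing fun x : E.BiPath => x.edge).isCompact_iff.2 ?_⟩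
  convert isCompact_setOf_forall_rel (fun e f => E.s e = E.r f) id (· + 1 : ℤ → ℤ)
  exact Set.ext fun z => ⟨by rintro ⟨x, -, rfl⟩; exact x.chain, fun hz => ⟨⟨z, hz⟩, trivial, rfl⟩⟩

theorem LeftPath.eventually_final_eq (x : E.LeftPath) (n : ℕ) :
    ∀ᶠ y : E.LeftPath in 𝓝 x, y.final n = x.final n := by
  let _ : TopologicalSpace Edge := ⊥
  have : DiscreteTopology Edge := ⟨rfl⟩
  have hedge : ∀ i, ∀ᶠ y : E.LeftPath in 𝓝 x, y.edge i = x.edge i := fun i =>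
    ((continuous_apply i).comp continuous_induced_dom).continuousAt.preimage_mem_nhds
      (t := {x.edge i}) (by simp)
  filter_upwards [(Finset.range n).eventually_all.2 fun i _ => hedge i] with y hy
  exact List.map_congr_left fun i hi => hy i (by simpa using hi)

theorem BiPath.exists_forall_edge_eq_mem {U : Set E.BiPath} (hU : IsOpen U) {x : E.BiPath}
    (hx : x ∈ U) :
    ∃ k : ℕ, ∀ y : E.BiPath, (∀ i : ℤ, -k ≤ i → i ≤ k → y.edge i = x.edge i) → y ∈ U := by
  let _ : TopologicalSpace Edge := ⊥
  obtain ⟨W, hW, rfl⟩ := isOpen_induced_iff.1 hU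
  obtain ⟨I, u, hu, hIW⟩ := isOpen_pi_iff.1 hW _ hx
  refine ⟨I.sup Int.natAbs, fun y hy => hIW fun i hi => ?_⟩
  have hik : i.natAbs ≤ I.sup Int.natAbs := Finset.le_sup hi
  change y.edge i ∈ u i
  rw [hy i (by omega) (by omega)]
  exact (hu i hi).2

theorem BiPath.continuous_leftPart (n : ℤ) : Continuous fun x : E.BiPath => x.leftPart n := by
  let _ : TopologicalSpace Edge := ⊥
  refine continuous_induced_rng.2 (continuous_pi fun k => ?_)
  exact (continuous_apply (n - (k : ℤ))).comp continuous_induced_dom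

end DirectedGraph

namespace SelfSimilarAction

variable {V : Type u} {Edge : Type v} {E : DirectedGraph V Edge} [Groupoid.{w} V]
  (A : SelfSimilarAction E) [Finite V]

instance [Finite Edge] : CompactSpace A.LimitSpace :=
  inferInstanceAs (CompactSpace (Quotient A.leftSetoid))

instance [Finite Edge] : CompactSpace A.Solenoid :=
  inferInstanceAs (CompactSpace (Quotient A.biSetoid))

theorem isQuotientMap_toLimitSpace : IsQuotientMap A.toLimitSpace := isQuotientMap_quot_mk

theorem isQuotientMap_toSolenoid : IsQuotientMap A.toSolenoid := isQuotientMap_quot_mk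

theorem toLimitSpace_eq_iff {x y : E.LeftPath} :
    A.toLimitSpace x = A.toLimitSpace y ↔ A.LeftAsymp x y := Quotient.eq (r := A.leftSetoid)

theorem toSolenoid_eq_iff {x y : E.BiPath} :
    A.toSolenoid x = A.toSolenoid y ↔ A.BiAsymp x y := Quotient.eq (r := A.biSetoid)

variable {A}

theorem isExpandingMetric_iff {d : A.LimitSpace → A.LimitSpace → ℝ} {ε c : ℝ} :
    A.IsExpandingMetric d ε c ↔ IsCompatibleMetric d ∧ IsLocallyScaling d A.shiftLimit ε c :=
  ⟨fun h => ⟨h.compatible, h.ε_pos, h.one_lt, h.expand, h.image_ball⟩,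
    fun ⟨hd, h⟩ => ⟨hd, h.ε_pos, h.one_lt, h.expand, h.image_ball⟩⟩

theorem exists_isExpandingMetric [Finite Edge] (hs : E.NoSources) (hc : A.IsContracting)
    (hr : A.IsRegular) : ∃ d ε c, A.IsExpandingMetric d ε c := by
  obtain ⟨N, hN⟩ := exists_isNucleus hs hc
  obtain ⟨m, k, hscale⟩ := hN.exists_isExpandingScale_nucRel hs hr
  obtain ⟨d, ε, c, hd, hzero, hsmall, hexp⟩ := hscale.exists_isLocallyScaling
  obtain ⟨D, hD, hDd⟩ := hd.exists_isCompatibleMetric_of_isQuotientMap A.isQuotientMap_toLimitSpace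
    (fun x y => by rw [hzero, A.toLimitSpace_eq_iff, hN.leftAsymp_iff]) fun x δ hδ => by
      obtain ⟨n, hn⟩ := hsmall δ hδ
      filter_upwards [x.eventually_final_eq n] with y hy
      exact hn x y (hN.nucRel_of_final_eq hy.symm)
  exact ⟨D, ε, c, isExpandingMetric_iff.2
    ⟨hD, hexp.of_semiconj A.isQuotientMap_toLimitSpace.surjective hDd fun _ => rfl⟩⟩

end SelfSimilarAction

/-! ### Inverse limits of locally scaling maps -/

theorem continuousOn_of_isClosed_graphOn {X Y : Type*} [TopologicalSpace X] [TopologicalSpace Y]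
    [CompactSpace Y] {g : X → Y} {s : Set X} (h : IsClosed (s.graphOn g)) : ContinuousOn g s := by
  refine continuousOn_iff_isClosed.2 fun C hC => ⟨Prod.fst '' (s.graphOn g ∩ Prod.snd ⁻¹' C),
    isClosedMap_fst_of_compactSpace _ (h.inter (hC.preimage continuous_snd)), ?_⟩
  ext x
  simp only [Set.mem_inter_iff, Set.mem_preimage, Set.mem_image, Set.mem_graphOn, Prod.exists]
  constructor
  · exact fun ⟨hx, hxs⟩ => ⟨⟨x, g x, ⟨⟨hxs, rfl⟩, hx⟩, rfl⟩, hxs⟩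
  · rintro ⟨⟨_, _, ⟨⟨_, rfl⟩, hx⟩, rfl⟩, hxs⟩
    exact ⟨hx, hxs⟩

theorem preimage_localStableSet_mem_nhds {X : Type*} [TopologicalSpace X] {d : X → X → ℝ}
    {φ : X ≃ₜ X} {ε δ : ℝ} {br : X → X → X} {x : X} (hε : 0 < ε) (hδ : 0 < δ)
    (y : stableClass d φ x) (hself : d y.1 y.1 = 0) (hbr : br y.1 y.1 = y.1) :
    Subtype.val ⁻¹' localStableSet d br y.1 δ ∈ @nhds _ (stableTopology d φ ε br x) y := by
  let _ : TopologicalSpace (stableClass d φ x) := stableTopology d φ ε br x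
  have hmin : 0 < min δ (ε / 2) := lt_min hδ (half_pos hε)
  have hopen : IsOpen[stableTopology d φ ε br x]
      (Subtype.val ⁻¹' localStableSet d br y.1 (min δ (ε / 2))) :=
    TopologicalSpace.isOpen_generateFrom_of_mem
      ⟨y.1, y.2, _, hmin, (min_le_right _ _).trans_lt (half_lt_self hε), rfl⟩
  refine mem_of_superset (hopen.mem_nhds ⟨by rwa [hself], hbr⟩) fun z hz => ?_
  exact ⟨hz.1.trans_le (min_le_left _ _), hz.2⟩

/-- The topology of `X^s(x)` is finer than that of `X`, and makes the fibres of `p` open. -/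
theorem totallyDisconnectedSpace_stableClass {X Z : Type*} [TopologicalSpace X] {d : X → X → ℝ}
    {φ : X ≃ₜ X} {ε δ : ℝ} {br : X → X → X} (hd : IsCompatibleMetric d) (hbr : ∀ x, br x x = x)
    (hε : 0 < ε) (hδ : 0 < δ) {p : X → Z} (hp : ∀ x, localStableSet d br x δ ⊆ p ⁻¹' {p x})
    (hfiber : ∀ z, IsTotallyDisconnected (p ⁻¹' {z})) (x : X) :
    @TotallyDisconnectedSpace (stableClass d φ x) (stableTopology d φ ε br x) := by
  let _ : TopologicalSpace (stableClass d φ x) := stableTopology d φ ε br x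
  have hnhds : ∀ (y : stableClass d φ x) (r : ℝ), 0 < r →
      Subtype.val ⁻¹' localStableSet d br y.1 r ∈ 𝓝 y := fun y r hr =>
    preimage_localStableSet_mem_nhds hε hr y (hd.self _) (hbr _)
  have hval : Continuous (Subtype.val : stableClass d φ x → X) := by
    refine continuous_def.2 fun U hU => isOpen_iff_mem_nhds.2 fun y hy => ?_
    obtain ⟨r, hr, hrU⟩ := (hd.isOpen_iff U).1 hU y.1 hy
    exact mem_of_superset (hnhds y r hr) fun z hz => hrU _ hz.1
  have hconst : IsLocallyConstant fun y : stableClass d φ x => p y.1 :=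
    (IsLocallyConstant.iff_eventually_eq _).2 fun y =>
      mem_of_superset (hnhds y δ hδ) fun z hz => hp y.1 hz
  refine ⟨fun T _ hT s hs t ht => Subtype.ext ?_⟩
  refine hfiber (p t.1) (Subtype.val '' T) ?_ (hT.image _ hval.continuousOn) ⟨s, hs, rfl⟩
    ⟨t, ht, rfl⟩
  rintro _ ⟨y, hy, rfl⟩
  exact hconst.apply_eq_of_isPreconnected hT hy ht

/-- `S` with the projections `π m` is the inverse limit of `⋯ → J → J → J`, all maps being `f`, and
`φ` is the homeomorphism of `S` induced by `f`. -/
structure IsInverseLimit {J S : Type*} [TopologicalSpace J] [TopologicalSpace S] (f : J → J)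
    (π : ℕ → S → J) (φ : S ≃ₜ S) : Prop where
  continuous : ∀ m, Continuous (π m)
  map_succ : ∀ m s, f (π (m + 1) s) = π m s
  ext : ∀ s t, (∀ m, π m s = π m t) → s = t
  exists_of : ∀ z : ℕ → J, (∀ m, f (z (m + 1)) = z m) → ∃ s, ∀ m, π m s = z m
  zero_apply : ∀ s, π 0 (φ s) = f (π 0 s)
  succ_apply : ∀ m s, π (m + 1) (φ s) = π m s

theorem IsInverseLimit.apply_symm {J S : Type*} [TopologicalSpace J] [TopologicalSpace S]
    {f : J → J} {π : ℕ → S → J} {φ : S ≃ₜ S} (hS : IsInverseLimit f π φ) (m : ℕ) (s : S) :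
    π m (φ.symm s) = π (m + 1) s := by
  rw [← hS.succ_apply, φ.apply_symm_apply]

section InverseLimit

variable {J S : Type*} [MetricSpace J] {f : J → J} {ε c : ℝ} {π : ℕ → S → J}

variable (c π) in
/-- The metric `sup_m (1/c)^m d(π m s, π m t)` on an inverse limit. -/
noncomputable def supDist (s t : S) : ℝ := ⨆ m : ℕ, (1 / c) ^ m * dist (π m s) (π m t)

theorem supDist_le {s t : S} {b : ℝ} (h : ∀ m, (1 / c) ^ m * dist (π m s) (π m t) ≤ b) :
    supDist c π s t ≤ b := ciSup_le h

section Compact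

variable [CompactSpace J]

theorem isLUB_supDist (hc : 1 < c) (s t : S) :
    IsLUB (Set.range fun m : ℕ => (1 / c) ^ m * dist (π m s) (π m t)) (supDist c π s t) := by
  refine isLUB_ciSup ⟨Metric.diam (Set.univ : Set J), ?_⟩
  rintro _ ⟨m, rfl⟩
  have hpow : (1 / c) ^ m ≤ 1 :=
    pow_le_one₀ (by positivity) ((div_le_one (by positivity)).2 hc.le)
  exact (mul_le_of_le_one_left dist_nonneg hpow).trans
    (Metric.dist_le_diam_of_mem isCompact_univ.isBounded trivial trivial)

theorem le_supDist (hc : 1 < c) (s t : S) (m : ℕ) :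
    (1 / c) ^ m * dist (π m s) (π m t) ≤ supDist c π s t := (isLUB_supDist hc s t).1 ⟨m, rfl⟩

theorem dist_zero_le_supDist (hc : 1 < c) (s t : S) : dist (π 0 s) (π 0 t) ≤ supDist c π s t := by
  simpa using le_supDist hc s t 0

theorem isPseudometric_supDist (hc : 1 < c) : IsPseudometric (supDist c π) where
  self s := by simp [supDist]
  comm s t := by simp only [supDist, dist_comm]
  triangle s t r := supDist_le fun m => by
    calc (1 / c) ^ m * dist (π m s) (π m r)
        ≤ (1 / c) ^ m * (dist (π m s) (π m t) + dist (π m t) (π m r)) := by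
          gcongr; exact dist_triangle _ _ _
      _ ≤ supDist c π s t + supDist c π t r := by
          rw [mul_add]; exact add_le_add (le_supDist hc s t m) (le_supDist hc t r m)

theorem eq_of_supDist_eq_zero (hc : 1 < c) {s t : S} (h : supDist c π s t = 0) (m : ℕ) :
    π m s = π m t :=
  dist_le_zero.1 <| nonpos_of_mul_nonpos_right (h ▸ le_supDist hc s t m) (by positivity)

theorem eventually_supDist_lt [TopologicalSpace S] (hc : 1 < c) (hπ : ∀ m, Continuous (π m))
    (s : S) {δ : ℝ} (hδ : 0 < δ) : ∀ᶠ t in 𝓝 s, supDist c π s t < δ := by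
  have hc1 : 1 / c < 1 := (div_lt_one (by positivity)).2 hc
  have htail := (tendsto_pow_atTop_nhds_zero_of_lt_one (by positivity) hc1).mul_const
    (Metric.diam (Set.univ : Set J))
  rw [zero_mul] at htail
  obtain ⟨M, hM⟩ := (htail.eventually (gt_mem_nhds (half_pos hδ))).exists
  have hhead : ∀ᶠ t in 𝓝 s, ∀ m ∈ Finset.range M, dist (π m s) (π m t) < δ / 2 :=
    (Finset.range M).eventually_all.2 fun m _ =>
      (continuous_const.dist (hπ m)).continuousAt.eventually
        (gt_mem_nhds (by simpa using half_pos hδ))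
  filter_upwards [hhead] with t ht
  refine (supDist_le fun m => ?_).trans_lt (half_lt_self hδ)
  rcases lt_or_ge m M with hm | hm
  · exact (mul_le_of_le_one_left dist_nonneg (pow_le_one₀ (by positivity) hc1.le)).trans
      (ht m (Finset.mem_range.2 hm)).le
  · calc (1 / c) ^ m * dist (π m s) (π m t)
        ≤ (1 / c) ^ M * Metric.diam (Set.univ : Set J) :=
          mul_le_mul (pow_le_pow_of_le_one (by positivity) hc1.le hm)
            (Metric.dist_le_diam_of_mem isCompact_univ.isBounded trivial trivial) dist_nonneg
            (by positivity)
      _ ≤ δ / 2 := hM.le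

theorem isCompatibleMetric_supDist [TopologicalSpace S] [CompactSpace S] (hc : 1 < c)
    (hπ : ∀ m, Continuous (π m)) (hext : ∀ s t, (∀ m, π m s = π m t) → s = t) :
    IsCompatibleMetric (supDist c π) :=
  (isPseudometric_supDist hc).isCompatibleMetric
    (fun s t h => hext s t (eq_of_supDist_eq_zero hc h))
    fun s _ hδ => eventually_supDist_lt hc hπ s hδ

end Compact

theorem IsLocallyScaling.exists_preimage (hf : IsLocallyScaling dist f ε c) {u v : J} {α : ℝ}
    (hα : α ≤ ε) (h : dist u (f v) < c * α) : ∃ u', f u' = u ∧ dist u' v < α := by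
  have hmem : u ∈ {z | dist (f v) z < c * α} := by rwa [Set.mem_ofPred_eq, dist_comm]
  rw [← hf.image_ball v α hα] at hmem
  obtain ⟨u', hu', rfl⟩ := hmem
  exact ⟨u', rfl, by rwa [dist_comm]⟩

theorem IsLocallyScaling.eq_of_map_eq (hf : IsLocallyScaling dist f ε c) {u v : J}
    (h : dist u v < ε) (huv : f u = f v) : u = v := by
  have hscale := hf.expand u v h
  rw [huv, dist_self, eq_comm, mul_eq_zero] at hscale
  exact dist_eq_zero.1 (hscale.resolve_left (zero_lt_one.trans hf.one_lt).ne')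

variable (ε π) in
/-- The defining property of `w = [s, t]` in an inverse limit: `w` has the same image as `s` under
`π 0`, and it is `ε / 2`-close to `t` at all levels. -/
def IsBracket (s t w : S) : Prop := π 0 w = π 0 s ∧ ∀ m, dist (π m w) (π m t) < ε / 2

open Classical in
variable (ε π) in
/-- The bracket `[s, t]` of an inverse limit; its value is `s` if no point satisfies
`IsBracket ε π s t`. -/
noncomputable def bracket (s t : S) : S :=
  if h : ∃ w, IsBracket ε π s t w then h.choose else s

variable [TopologicalSpace S] {φ : S ≃ₜ S} {s t w w' : S}

theorem exists_isBracket (hf : IsLocallyScaling dist f ε c) (hS : IsInverseLimit f π φ)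
    (h : dist (π 0 s) (π 0 t) < ε / 2) : ∃ w, IsBracket ε π s t w := by
  have hlift : ∀ (m : ℕ) (u : {u : J // dist u (π m t) < ε / 2}),
      ∃ u' : {u : J // dist u (π (m + 1) t) < ε / 2}, f u'.1 = u.1 := by
    rintro m ⟨u, hu⟩
    rw [← hS.map_succ] at hu
    have hlt : ε / 2 < c * (ε / 2) := lt_mul_of_one_lt_left (half_pos hf.ε_pos) hf.one_lt
    obtain ⟨u', hu', hdist⟩ := hf.exists_preimage (half_le_self hf.ε_pos.le) (hu.trans hlt)
    exact ⟨⟨u', hdist⟩, hu'⟩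
  choose F hF using hlift
  let z : ∀ m : ℕ, {u : J // dist u (π m t) < ε / 2} := fun m => Nat.rec ⟨_, h⟩ F m
  obtain ⟨w, hw⟩ := hS.exists_of (fun m => (z m).1) fun m => hF m (z m)
  exact ⟨w, hw 0, fun m => by rw [hw m]; exact (z m).2⟩

theorem IsBracket.dist_eq (hf : IsLocallyScaling dist f ε c) (hS : IsInverseLimit f π φ)
    (h : IsBracket ε π s t w) (m : ℕ) :
    dist (π m w) (π m t) = (1 / c) ^ m * dist (π 0 s) (π 0 t) := by
  have hc0 : c ≠ 0 := (zero_lt_one.trans hf.one_lt).ne'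
  induction m with
  | zero => rw [h.1, pow_zero, one_mul]
  | succ m ih =>
    have hscale := hf.expand _ _ ((h.2 (m + 1)).trans (half_lt_self hf.ε_pos))
    rw [hS.map_succ, hS.map_succ, ih] at hscale
    rw [pow_succ, mul_right_comm, hscale]
    field_simp

theorem IsBracket.dist_le (hf : IsLocallyScaling dist f ε c) (hS : IsInverseLimit f π φ)
    (h : IsBracket ε π s t w) (m : ℕ) : dist (π m w) (π m t) ≤ dist (π 0 s) (π 0 t) := by
  have hc := hf.one_lt
  rw [h.dist_eq hf hS]
  exact mul_le_of_le_one_left dist_nonneg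
    (pow_le_one₀ (by positivity) ((div_le_one (by positivity)).2 hc.le))

theorem IsBracket.unique (hf : IsLocallyScaling dist f ε c) (hS : IsInverseLimit f π φ)
    (h : IsBracket ε π s t w) (h' : IsBracket ε π s t w') : w = w' := by
  refine hS.ext _ _ fun m => ?_
  induction m with
  | zero => rw [h.1, h'.1]
  | succ m ih =>
    refine hf.eq_of_map_eq ?_ (by rw [hS.map_succ, hS.map_succ, ih])
    linarith [dist_triangle_right (π (m + 1) w) (π (m + 1) w') (π (m + 1) t), h.2 (m + 1),
      h'.2 (m + 1)]

theorem isBracket_bracket (hf : IsLocallyScaling dist f ε c) (hS : IsInverseLimit f π φ)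
    (h : dist (π 0 s) (π 0 t) < ε / 2) : IsBracket ε π s t (bracket ε π s t) := by
  have hex := exists_isBracket hf hS h
  rw [bracket, dif_pos hex]
  exact hex.choose_spec

theorem IsBracket.bracket_eq (hf : IsLocallyScaling dist f ε c) (hS : IsInverseLimit f π φ)
    (h : IsBracket ε π s t w) : bracket ε π s t = w := by
  have hex : ∃ w, IsBracket ε π s t w := ⟨w, h⟩
  rw [bracket, dif_pos hex]
  exact hex.choose_spec.unique hf hS h

theorem bracket_self (hf : IsLocallyScaling dist f ε c) (hS : IsInverseLimit f π φ) (s : S) :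
    bracket ε π s s = s :=
  IsBracket.bracket_eq hf hS ⟨rfl, fun m => by simpa using hf.ε_pos⟩

theorem continuousOn_bracket [CompactSpace S] (hf : IsLocallyScaling dist f ε c)
    (hS : IsInverseLimit f π φ) {δ : ℝ} (hδ : δ < ε / 2) :
    ContinuousOn (fun p : S × S => bracket ε π p.1 p.2) {p | dist (π 0 p.1) (π 0 p.2) ≤ δ} := by
  have hgraph : Set.graphOn (fun p : S × S => bracket ε π p.1 p.2)
      {p | dist (π 0 p.1) (π 0 p.2) ≤ δ} =
      {p | π 0 p.2 = π 0 p.1.1} ∩ ⋂ m, {p | dist (π m p.2) (π m p.1.2) ≤ δ} := by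
    ext ⟨⟨s, t⟩, w⟩
    simp only [Set.mem_graphOn, Set.mem_ofPred_eq, Set.mem_inter_iff, Set.mem_iInter]
    constructor
    · rintro ⟨hst, rfl⟩
      have hbr := isBracket_bracket hf hS (hst.trans_lt hδ)
      exact ⟨hbr.1, fun m => (hbr.dist_le hf hS m).trans hst⟩
    · rintro ⟨hw, hdist⟩
      exact ⟨hw ▸ hdist 0, IsBracket.bracket_eq hf hS ⟨hw, fun m => (hdist m).trans_lt hδ⟩⟩
  have hπ := hS.continuous
  refine continuousOn_of_isClosed_graphOn (hgraph ▸ ?_)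
  exact (isClosed_eq (by fun_prop) (by fun_prop)).inter
    (isClosed_iInter fun m => isClosed_le (by fun_prop) continuous_const)

theorem bracket_bracket_right (hf : IsLocallyScaling dist f ε c) (hS : IsInverseLimit f π φ)
    {x y z : S} (hyz : dist (π 0 y) (π 0 z) < ε / 4)
    (hx : dist (π 0 x) (π 0 (bracket ε π y z)) < ε / 4) :
    bracket ε π x (bracket ε π y z) = bracket ε π x z := by
  have hε := hf.ε_pos
  have hyz' := isBracket_bracket hf hS (s := y) (t := z) (by linarith)
  have hx' := isBracket_bracket hf hS (s := x) (t := bracket ε π y z) (by linarith)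
  refine (IsBracket.bracket_eq hf hS ⟨hx'.1, fun m => ?_⟩).symm
  linarith [dist_triangle (π m (bracket ε π x (bracket ε π y z))) (π m (bracket ε π y z)) (π m z),
    hyz'.dist_le hf hS m, hx'.dist_le hf hS m]

theorem bracket_bracket_left (hf : IsLocallyScaling dist f ε c) (hS : IsInverseLimit f π φ)
    {x y z : S} (hxy : dist (π 0 x) (π 0 y) < ε / 2)
    (hz : dist (π 0 (bracket ε π x y)) (π 0 z) < ε / 2) :
    bracket ε π (bracket ε π x y) z = bracket ε π x z :=
  have hbr := isBracket_bracket hf hS hz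
  (IsBracket.bracket_eq hf hS ⟨hbr.1.trans (isBracket_bracket hf hS hxy).1, hbr.2⟩).symm

theorem map_bracket (hf : IsLocallyScaling dist f ε c) (hS : IsInverseLimit f π φ) {x y : S}
    (hxy : dist (π 0 x) (π 0 y) < ε / 2) (hφ : dist (π 0 (φ x)) (π 0 (φ y)) < ε / 2) :
    φ (bracket ε π x y) = bracket ε π (φ x) (φ y) := by
  have hbr := isBracket_bracket hf hS hxy
  have hzero : π 0 (φ (bracket ε π x y)) = π 0 (φ x) := by
    rw [hS.zero_apply, hS.zero_apply, hbr.1]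
  refine (IsBracket.bracket_eq hf hS ⟨hzero, fun m => ?_⟩).symm
  cases m with
  | zero => rwa [hzero]
  | succ m => simpa only [hS.succ_apply] using hbr.2 m

theorem supDist_map_le [CompactSpace J] (hc : 1 < c) (hS : IsInverseLimit f π φ) {x y : S}
    (hxy : π 0 x = π 0 y) : supDist c π (φ x) (φ y) ≤ 1 / c * supDist c π x y := by
  refine supDist_le fun m => ?_
  cases m with
  | zero =>
    have hnonneg := dist_nonneg.trans (dist_zero_le_supDist (π := π) hc x y)
    simp only [hS.zero_apply, hxy, dist_self, mul_zero]
    positivity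
  | succ m =>
    simp only [hS.succ_apply, pow_succ', mul_assoc]
    gcongr
    exact le_supDist hc x y m

theorem IsBracket.supDist_symm_le [CompactSpace J] (hf : IsLocallyScaling dist f ε c)
    (hS : IsInverseLimit f π φ) {x y : S} (h : IsBracket ε π x y x) :
    supDist c π (φ.symm x) (φ.symm y) ≤ 1 / c * supDist c π x y := by
  have hc := hf.one_lt
  have hpow : ∀ m, (1 / c) ^ m ≤ 1 := fun m =>
    pow_le_one₀ (by positivity) ((div_le_one (by positivity)).2 hc.le)
  refine supDist_le fun m => ?_
  calc (1 / c) ^ m * dist (π m (φ.symm x)) (π m (φ.symm y))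
      = (1 / c) ^ m * (1 / c * (1 / c) ^ m * dist (π 0 x) (π 0 y)) := by
        rw [hS.apply_symm, hS.apply_symm, h.dist_eq hf hS, pow_succ']
    _ ≤ 1 * (1 / c * 1 * supDist c π x y) := by
        gcongr
        exacts [hpow m, hpow m, dist_zero_le_supDist hc x y]
    _ = 1 / c * supDist c π x y := by ring

theorem isSmaleSpace_of_isInverseLimit [CompactSpace J] [CompactSpace S]
    (hf : IsLocallyScaling dist f ε c) (hS : IsInverseLimit f π φ) :
    IsSmaleSpace (supDist c π) φ (ε / 8) (1 / c) (bracket ε π) := by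
  have hε := hf.ε_pos
  have hc := hf.one_lt
  have hnear : ∀ {s t : S}, supDist c π s t ≤ ε / 8 → dist (π 0 s) (π 0 t) ≤ ε / 8 := fun h =>
    (dist_zero_le_supDist hc _ _).trans h
  have hbr : ∀ {s t : S}, supDist c π s t ≤ ε / 8 → IsBracket ε π s t (bracket ε π s t) :=
    fun h => isBracket_bracket hf hS (by linarith [hnear h])
  exact
    { compact := inferInstance
      metric := isCompatibleMetric_supDist hc hS.continuous hS.ext
      ε_pos := by positivity
      lam_pos := by positivity
      lam_lt_one := (div_lt_one (by positivity)).2 hc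
      continuousOn := (continuousOn_bracket hf hS (by linarith)).mono fun p hp => hnear hp
      b1 := bracket_self hf hS
      b2 := fun x y z hyz hx _ =>
        bracket_bracket_right hf hS (by linarith [hnear hyz]) (by linarith [hnear hx])
      b3 := fun x y z hxy hz _ =>
        bracket_bracket_left hf hS (by linarith [hnear hxy]) (by linarith [hnear hz])
      b4 := fun x y hxy hφ =>
        map_bracket hf hS (by linarith [hnear hxy]) (by linarith [hnear hφ])
      c1 := fun x y hxy h => supDist_map_le hc hS (h ▸ (hbr hxy).1).symm
      c2 := fun x y hxy h =>
        IsBracket.supDist_symm_le hf hS (by simpa only [h] using hbr hxy) }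

/-- The fibres of `f` are uniformly discrete, so a connected part of a fibre of `π 0` has a single
image under each `π m`. -/
theorem IsInverseLimit.isTotallyDisconnected_fiber (hS : IsInverseLimit f π φ)
    (hf : IsLocallyScaling dist f ε c) (z : J) : IsTotallyDisconnected (π 0 ⁻¹' {z}) := by
  intro T hTz hT
  suffices hπT : ∀ m, (π m '' T).Subsingleton from
    fun s hs t ht => hS.ext s t fun m => hπT m ⟨s, hs, rfl⟩ ⟨t, ht, rfl⟩
  intro m
  induction m with
  | zero => exact Set.subsingleton_singleton.anti (Set.image_subset_iff.2 hTz)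
  | succ m ih =>
    have hsep : Pairwise fun a b : π (m + 1) '' T => ε ≤ dist a b := by
      rintro ⟨_, s, hs, rfl⟩ ⟨_, t, ht, rfl⟩ hst
      contrapose! hst
      refine Subtype.ext (hf.eq_of_map_eq hst ?_)
      simpa only [hS.map_succ] using ih ⟨s, hs, rfl⟩ ⟨t, ht, rfl⟩
    have := DiscreteTopology.of_forall_le_dist hf.ε_pos hsep
    have := Subtype.preconnectedSpace (hT.image _ (hS.continuous (m + 1)).continuousOn)
    exact (Set.subsingleton_coe _).1 PreconnectedSpace.trivial_of_discrete

theorem localStableSet_subset_fiber [CompactSpace J] (hf : IsLocallyScaling dist f ε c)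
    (hS : IsInverseLimit f π φ) {δ : ℝ} (hδ : δ ≤ ε / 2) (x : S) :
    localStableSet (supDist c π) (bracket ε π) x δ ⊆ π 0 ⁻¹' {π 0 x} := by
  rintro y ⟨hxy, hbr⟩
  have hdist : dist (π 0 y) (π 0 x) < ε / 2 := by
    rw [dist_comm]
    exact (dist_zero_le_supDist hf.one_lt x y).trans_lt (hxy.trans_le hδ)
  simpa [hbr, eq_comm] using (isBracket_bracket hf hS hdist).1

theorem hasTotallyDisconnectedStableSets_of_isInverseLimit [CompactSpace J] [CompactSpace S]
    (hf : IsLocallyScaling dist f ε c) (hS : IsInverseLimit f π φ) :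
    HasTotallyDisconnectedStableSets (supDist c π) φ (ε / 8) (bracket ε π) := by
  have hε := hf.ε_pos
  have hfiber := hS.isTotallyDisconnected_fiber hf
  refine ⟨fun x δ _ hδ T hT => hfiber _ T (hT.trans (localStableSet_subset_fiber hf hS ?_ x)), ?_⟩
  · linarith
  · exact totallyDisconnectedSpace_stableClass
      (isCompatibleMetric_supDist hf.one_lt hS.continuous hS.ext) (bracket_self hf hS)
      (by positivity) (half_pos hε) (localStableSet_subset_fiber hf hS le_rfl) hfiber

end InverseLimit

/-! ### The limit solenoid -/

theorem exists_mem_forall_of_antitone {α : Type*} {s : Set α} (hs : s.Finite) {P : ℕ → α → Prop}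
    (hP : Antitone P) (h : ∀ k, ∃ a ∈ s, P k a) : ∃ a ∈ s, ∀ k, P k a := by
  by_contra! hne
  have hev : ∀ᶠ k in atTop, ∀ a ∈ s, ¬P k a := (eventually_all_finite hs).2 fun a ha => by
    obtain ⟨k, hk⟩ := hne a ha
    filter_upwards [eventually_ge_atTop k] with l hl hPl using hk (hP hl a hPl)
  obtain ⟨k, hk⟩ := hev.exists
  obtain ⟨a, ha, hPa⟩ := h k
  exact hk a ha hPa

namespace DirectedGraph

attribute [ext] LeftPath BiPath

variable {V : Type u} {Edge : Type v} {E : DirectedGraph V Edge}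

namespace BiPath

variable (x : E.BiPath)

theorem final_leftPart (m : ℤ) (n : ℕ) : (x.leftPart m).final n = x.segment (m - n + 1) n := by
  apply List.ext_getElem
  · simp [segment]
  · intro i hi _
    rw [LeftPath.length_final] at hi
    simp only [LeftPath.final, segment, leftPart, List.getElem_map, List.getElem_reverse,
      List.getElem_range, List.length_range]
    congr 1
    omega

theorem segment_succ (n : ℤ) (k : ℕ) :
    x.segment n (k + 1) = x.segment n k ++ [x.edge (n + k)] := by
  simp [segment, List.range_succ]

theorem shift_leftPart (m : ℤ) : (x.leftPart m).shift = x.leftPart (m - 1) :=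
  LeftPath.ext <| funext fun k => congrArg x.edge (by push_cast; omega)

/-- The power `τ^k` of the translation, for an integer `k`. -/
def translateBy (k : ℤ) (x : E.BiPath) : E.BiPath :=
  ⟨fun n => x.edge (n - k), fun n => by rw [x.chain, sub_add_eq_add_sub]⟩

theorem translateBy_zero : x.translateBy 0 = x :=
  BiPath.ext <| funext fun n => congrArg x.edge (sub_zero n)

theorem translateBy_translateBy (k l : ℤ) :
    (x.translateBy k).translateBy l = x.translateBy (k + l) :=
  BiPath.ext <| funext fun n => congrArg x.edge (by omega)

theorem iterate_translate (N : ℕ) : translate^[N] x = x.translateBy N := by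
  induction N with
  | zero => exact x.translateBy_zero.symm
  | succ N ih =>
    rw [Function.iterate_succ_apply', ih, Nat.cast_succ]
    exact x.translateBy_translateBy N 1

theorem leftPart_translateBy (k m : ℤ) : (x.translateBy k).leftPart m = x.leftPart (m - k) :=
  LeftPath.ext <| funext fun i => congrArg x.edge (by omega)

theorem segment_translateBy (k n : ℤ) (l : ℕ) :
    (x.translateBy k).segment n l = x.segment (n - k) l :=
  List.map_congr_left fun i _ => congrArg x.edge (by omega)

theorem continuous_translateBy (k : ℤ) : Continuous (translateBy (E := E) k) := by
  let _ : TopologicalSpace Edge := ⊥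
  exact continuous_induced_rng.2
    (continuous_pi fun n => (continuous_apply (n - k)).comp continuous_induced_dom)

end BiPath

theorem LeftPath.exists_biPath (x : E.LeftPath) (y : E.RightPath) (h : E.s (x.edge 0) = y.range)
    (m : ℤ) : ∃ z : E.BiPath, z.leftPart m = x ∧ ∀ k : ℕ, z.edge (m + 1 + k) = y.edge k := by
  let z : ℤ → Edge := fun n => if n ≤ m then x.edge (m - n).toNat else y.edge (n - m - 1).toNat
  have hx : ∀ k : ℕ, z (m - k) = x.edge k := fun k => by
    simp only [z]
    rw [if_pos (by omega)]
    congr 1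
    omega
  have hy : ∀ k : ℕ, z (m + 1 + k) = y.edge k := fun k => by
    simp only [z]
    rw [if_neg (by omega)]
    congr 1
    omega
  refine ⟨⟨z, fun n => ?_⟩, LeftPath.ext (funext hx), hy⟩
  rcases lt_trichotomy n m with hn | rfl | hn
  · obtain ⟨k, rfl⟩ : ∃ k : ℕ, n = m - (k + 1 : ℕ) := ⟨(m - n - 1).toNat, by omega⟩
    rw [show m - (k + 1 : ℕ) + 1 = m - k by omega, hx, hx, x.chain]
  · simpa using (congrArg E.s (hx 0)).trans (h.trans (congrArg E.r (hy 0)).symm)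
  · obtain ⟨k, rfl⟩ : ∃ k : ℕ, n = m + 1 + k := ⟨(n - m - 1).toNat, by omega⟩
    rw [show m + 1 + (k : ℤ) + 1 = m + 1 + (k + 1 : ℕ) by omega, hy, hy, y.chain]

theorem LeftPath.exists_append (x : E.LeftPath) {μ : List Edge}
    (hμ : E.IsPath (E.s (x.edge 0)) μ) :
    ∃ y : E.LeftPath, E.s (y.edge 0) = E.source (E.s (x.edge 0)) μ ∧
      ∀ i, y.edge (i + μ.length) = x.edge i := by
  induction μ generalizing x with
  | nil => exact ⟨x, rfl, fun _ => rfl⟩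
  | cons e μ ih =>
    obtain ⟨y, hsource, hy⟩ := ih (x.snoc e hμ.1.symm) hμ.2
    exact ⟨y, hsource, fun i => by
      rw [List.length_cons, add_comm μ.length, ← add_assoc]; exact hy (i + 1)⟩

/-- The right-infinite path `xₙ xₙ₊₁ …`. -/
def BiPath.rightPart (x : E.BiPath) (n : ℤ) : E.RightPath :=
  ⟨fun k => x.edge (n + k), fun k => by rw [x.chain, add_assoc, Nat.cast_succ]⟩

theorem BiPath.exists_splice (x y : E.BiPath) (k : ℕ) {μ : List Edge}
    (hμ : E.IsPath (E.s (y.edge k)) μ)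
    (hsource : E.source (E.s (y.edge k)) μ = E.r (x.edge (-k))) :
    ∃ z : E.BiPath, (∀ i : ℤ, -k ≤ i → z.edge i = x.edge i) ∧
      ∀ i : ℤ, i ≤ k → z.edge (i - (2 * k + 1 + μ.length : ℕ)) = y.edge i := by
  have hy0 : (y.leftPart k).edge 0 = y.edge k := congrArg y.edge (by simp)
  obtain ⟨w, hw, hwy⟩ := (y.leftPart k).exists_append (μ := μ) (by rwa [hy0])
  obtain ⟨z, hzw, hzx⟩ := w.exists_biPath (x.rightPart (-k))
    (by rw [hw, hy0, hsource]; exact congrArg _ (congrArg x.edge (by simp))) (-k - 1)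
  refine ⟨z, fun i hi => ?_, fun i hi => ?_⟩
  · obtain ⟨j, rfl⟩ : ∃ j : ℕ, i = -k + j := ⟨(i + k).toNat, by omega⟩
    exact (congrArg z.edge (by ring)).trans (hzx j)
  · obtain ⟨j, rfl⟩ : ∃ j : ℕ, i = k - j := ⟨(k - i).toNat, by omega⟩
    rw [← hzw] at hwy
    exact (congrArg z.edge (by push_cast; ring)).trans (hwy j)

namespace NoSources

variable (hs : E.NoSources)
include hs

theorem exists_rightPath (v : V) : ∃ y : E.RightPath, y.range = v := by
  choose e he using hs
  let a : ℕ → Edge := fun k => (fun f => e (E.s f))^[k] (e v)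
  exact ⟨⟨a, fun k => by simp only [a, Function.iterate_succ_apply', he]⟩, he v⟩

theorem exists_leftPart_eq (x : E.LeftPath) (m : ℤ) : ∃ z : E.BiPath, z.leftPart m = x := by
  obtain ⟨y, hy⟩ := hs.exists_rightPath (E.s (x.edge 0))
  obtain ⟨z, hz, -⟩ := x.exists_biPath y hy.symm m
  exact ⟨z, hz⟩

theorem exists_path_of_le {n l : ℕ}
    (hn : ∀ v w : V, ∃ μ : List Edge, μ.length = n ∧ E.IsPath v μ ∧ E.source v μ = w)
    (hnl : n ≤ l) (v w : V) :
    ∃ μ : List Edge, μ.length = l ∧ E.IsPath v μ ∧ E.source v μ = w := by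
  obtain ⟨y, rfl⟩ := hs.exists_rightPath v
  obtain ⟨ν, hν, hpath, hsource⟩ := hn (E.source y.range (y.initial (l - n))) w
  refine ⟨y.initial (l - n) ++ ν, ?_, isPath_append (y.isPath_initial _) hpath, ?_⟩
  · simp only [RightPath.initial, List.length_append, List.length_map, List.length_range]
    omega
  · rw [source_append, hsource]

end NoSources

end DirectedGraph

namespace SelfSimilarAction

variable {V : Type u} {Edge : Type v} {E : DirectedGraph V Edge} [Groupoid.{w} V]
  {A : SelfSimilarAction E}

theorem antitone_mapsTo_segment (x y : E.BiPath) (n : ℤ) :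
    Antitone fun k g => A.MapsTo g (x.segment n k) (y.segment n k) :=
  antitone_nat_of_succ_le fun k g h => by
    rw [BiPath.segment_succ, BiPath.segment_succ] at h
    exact h.of_concat

theorem BiAsymp.leftPart {x y : E.BiPath} (h : A.BiAsymp x y) (m : ℤ) :
    A.LeftAsymp (x.leftPart m) (y.leftPart m) := by
  obtain ⟨g, hg, hmaps⟩ := h
  refine ⟨fun n => g (m - (n + 1 : ℕ) + 1), hg.subset ?_, fun n => ?_⟩
  · rintro _ ⟨n, rfl⟩
    exact ⟨_, rfl⟩
  · rw [BiPath.final_leftPart, BiPath.final_leftPart]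
    exact hmaps _ _

theorem IsNucleus.biAsymp_of_forall_leftAsymp {N : Set (GroupoidElt V)} (hN : A.IsNucleus N)
    {x y : E.BiPath} (h : ∀ m : ℕ, A.LeftAsymp (x.leftPart m) (y.leftPart m)) :
    A.BiAsymp x y := by
  have hmaps : ∀ n : ℤ, ∃ g ∈ N, ∀ k, A.MapsTo g (x.segment n k) (y.segment n k) := by
    intro n
    refine exists_mem_forall_of_antitone hN.finite (antitone_mapsTo_segment x y n) fun k => ?_
    obtain ⟨l, m, hm, hkl⟩ : ∃ l m : ℕ, (m : ℤ) - l + 1 = n ∧ k ≤ l :=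
      ⟨n.natAbs + k + 1, (n + n.natAbs + k).toNat, by omega, by omega⟩
    obtain ⟨g, hg, hgl⟩ := hN.leftAsymp_iff.1 (h m) l
    rw [BiPath.final_leftPart, BiPath.final_leftPart, hm] at hgl
    exact ⟨g, hg, antitone_mapsTo_segment x y n hkl g hgl⟩
  choose g hg hgmaps using hmaps
  exact ⟨g, hN.finite.subset (Set.range_subset_iff.2 hg), hgmaps⟩

theorem BiAsymp.translateBy {x y : E.BiPath} (h : A.BiAsymp x y) (k : ℤ) :
    A.BiAsymp (x.translateBy k) (y.translateBy k) := by
  obtain ⟨g, hg, hmaps⟩ := h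
  refine ⟨fun n => g (n - k), hg.subset (Set.range_comp_subset_range _ g), fun n l => ?_⟩
  rw [BiPath.segment_translateBy, BiPath.segment_translateBy]
  exact hmaps _ _

variable [Finite V]

variable (A) in
/-- The homeomorphism `τ̃ : 𝒮 → 𝒮`, `[x] ↦ [τ(x)]`. -/
def translateSolenoid : A.Solenoid ≃ₜ A.Solenoid where
  toFun := Quotient.map' (s₁ := A.biSetoid) (s₂ := A.biSetoid) (BiPath.translateBy 1)
    fun _ _ h => BiAsymp.translateBy h 1
  invFun := Quotient.map' (s₁ := A.biSetoid) (s₂ := A.biSetoid) (BiPath.translateBy (-1))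
    fun _ _ h => BiAsymp.translateBy h (-1)
  left_inv := A.isQuotientMap_toSolenoid.surjective.forall.2 fun x => congrArg A.toSolenoid <|
    (x.translateBy_translateBy 1 (-1)).trans x.translateBy_zero
  right_inv := A.isQuotientMap_toSolenoid.surjective.forall.2 fun x => congrArg A.toSolenoid <|
    (x.translateBy_translateBy (-1) 1).trans x.translateBy_zero
  continuous_toFun := (BiPath.continuous_translateBy 1).quotient_map' _
  continuous_invFun := (BiPath.continuous_translateBy (-1)).quotient_map' _

theorem translateSolenoid_toSolenoid (x : E.BiPath) :
    A.translateSolenoid (A.toSolenoid x) = A.toSolenoid x.translate := rfl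

theorem iterate_translateSolenoid_toSolenoid (N : ℕ) (x : E.BiPath) :
    A.translateSolenoid^[N] (A.toSolenoid x) = A.toSolenoid (x.translateBy N) := by
  have hsemi : Function.Semiconj A.toSolenoid BiPath.translate A.translateSolenoid := fun _ => rfl
  rw [← x.iterate_translate, hsemi.iterate_right N x]

variable (A) in
/-- The map `𝒮 → 𝒥`, `[x] ↦ [x(-∞, m)]`. -/
def solenoidProj (m : ℕ) : A.Solenoid → A.LimitSpace :=
  Quotient.map' (s₁ := A.biSetoid) (s₂ := A.leftSetoid) (fun x => x.leftPart m)
    fun _ _ h => BiAsymp.leftPart h m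

theorem solenoidProj_toSolenoid (m : ℕ) (x : E.BiPath) :
    A.solenoidProj m (A.toSolenoid x) = A.toLimitSpace (x.leftPart m) := rfl

theorem continuous_solenoidProj (m : ℕ) : Continuous (A.solenoidProj m) :=
  (BiPath.continuous_leftPart m).quotient_map' _

theorem shiftLimit_toLimitSpace (x : E.LeftPath) :
    A.shiftLimit (A.toLimitSpace x) = A.toLimitSpace x.shift := rfl

theorem shiftLimit_solenoidProj_succ (m : ℕ) (s : A.Solenoid) :
    A.shiftLimit (A.solenoidProj (m + 1) s) = A.solenoidProj m s := by
  obtain ⟨x, rfl⟩ := A.isQuotientMap_toSolenoid.surjective s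
  rw [solenoidProj_toSolenoid, solenoidProj_toSolenoid, shiftLimit_toLimitSpace,
    BiPath.shift_leftPart, Nat.cast_succ, add_sub_cancel_right]

theorem exists_solenoidProj_eq [Finite Edge] [T1Space A.LimitSpace] (hs : E.NoSources)
    {z : ℕ → A.LimitSpace} (hz : ∀ m, A.shiftLimit (z (m + 1)) = z m) :
    ∃ s, ∀ m, A.solenoidProj m s = z m := by
  have hclosed : ∀ m, IsClosed (A.solenoidProj m ⁻¹' {z m}) := fun m =>
    isClosed_singleton.preimage (continuous_solenoidProj m)
  have hanti : ∀ m, A.solenoidProj (m + 1) ⁻¹' {z (m + 1)} ⊆ A.solenoidProj m ⁻¹' {z m} := by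
    intro m s hm
    rw [Set.mem_preimage, Set.mem_singleton_iff] at hm ⊢
    rw [← shiftLimit_solenoidProj_succ, hm, hz]
  have hnonempty : ∀ m, (A.solenoidProj m ⁻¹' {z m}).Nonempty := by
    intro m
    obtain ⟨u, hu⟩ := A.isQuotientMap_toLimitSpace.surjective (z m)
    obtain ⟨x, rfl⟩ := hs.exists_leftPart_eq u m
    exact ⟨A.toSolenoid x, hu⟩
  obtain ⟨s, hmem⟩ := IsCompact.nonempty_iInter_of_sequence_nonempty_isCompact_isClosed _ hanti
    hnonempty (hclosed 0).isCompact hclosed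
  exact ⟨s, Set.mem_iInter.1 hmem⟩

theorem IsNucleus.isInverseLimit_solenoid [Finite Edge] [T1Space A.LimitSpace]
    {N : Set (GroupoidElt V)} (hN : A.IsNucleus N) (hs : E.NoSources) :
    IsInverseLimit A.shiftLimit A.solenoidProj A.translateSolenoid where
  continuous := continuous_solenoidProj
  map_succ := shiftLimit_solenoidProj_succ
  ext := A.isQuotientMap_toSolenoid.surjective.forall₂.2 fun _ _ h => A.toSolenoid_eq_iff.2 <|
    hN.biAsymp_of_forall_leftAsymp fun m => A.toLimitSpace_eq_iff.1 (h m)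
  exists_of _ hz := exists_solenoidProj_eq hs hz
  zero_apply := A.isQuotientMap_toSolenoid.surjective.forall.2 fun x => congrArg A.toLimitSpace <|
    (x.leftPart_translateBy 1 0).trans (x.shift_leftPart 0).symm
  succ_apply m := A.isQuotientMap_toSolenoid.surjective.forall.2 fun x =>
    congrArg A.toLimitSpace <| (x.leftPart_translateBy 1 (m + 1 : ℕ)).trans <|
      congrArg x.leftPart (by push_cast; omega)

theorem exists_nonempty_iterate_translateSolenoid_inter {U W : Set A.Solenoid} (hU : IsOpen U)
    (hW : IsOpen W) (hUn : U.Nonempty) (hWn : W.Nonempty) :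
    ∃ (k : ℕ) (v w : V), ∀ μ : List Edge, E.IsPath v μ → E.source v μ = w →
      (A.translateSolenoid^[2 * k + 1 + μ.length] '' U ∩ W).Nonempty := by
  have hq := A.isQuotientMap_toSolenoid
  obtain ⟨⟨s, hs⟩, ⟨t, ht⟩⟩ := hUn, hWn
  obtain ⟨x, rfl⟩ := hq.surjective s
  obtain ⟨y, rfl⟩ := hq.surjective t
  obtain ⟨i, hi⟩ := BiPath.exists_forall_edge_eq_mem (hU.preimage hq.continuous) hs
  obtain ⟨j, hj⟩ := BiPath.exists_forall_edge_eq_mem (hW.preimage hq.continuous) ht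
  let k := max i j
  refine ⟨k, E.s (y.edge k), E.r (x.edge (-k)), fun μ hμ hsource => ?_⟩
  obtain ⟨z, hzx, hzy⟩ := x.exists_splice y k hμ hsource
  refine ⟨_, ⟨A.toSolenoid z, hi z fun n hn _ => hzx n (by omega), rfl⟩, ?_⟩
  rw [iterate_translateSolenoid_toSolenoid]
  exact hj _ fun n _ hn => hzy n (by omega)

theorem isIrreducibleHomeo_translateSolenoid (h : E.StronglyConnected) :
    IsIrreducibleHomeo A.translateSolenoid := by
  intro U W hU hW hUn hWn
  obtain ⟨k, v, w, hvw⟩ := exists_nonempty_iterate_translateSolenoid_inter hU hW hUn hWn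
  obtain ⟨μ, hμ, hsource⟩ := h.2 v w
  exact ⟨_, hvw μ hμ hsource⟩

theorem isMixingHomeo_translateSolenoid (hs : E.NoSources) (h : E.Primitive) :
    IsMixingHomeo A.translateSolenoid := by
  intro U W hU hW hUn hWn
  obtain ⟨k, v, w, hvw⟩ := exists_nonempty_iterate_translateSolenoid_inter hU hW hUn hWn
  obtain ⟨n, -, hn⟩ := h
  refine ⟨2 * k + 1 + n, fun N hN => ?_⟩
  obtain ⟨l, rfl⟩ : ∃ l, N = 2 * k + 1 + l := ⟨N - (2 * k + 1), by omega⟩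
  obtain ⟨μ, rfl, hμ, hsource⟩ := hs.exists_path_of_le hn (by omega : n ≤ l) v w
  exact hvw μ hμ hsource

end SelfSimilarAction

/-- The metric space structure given by a compatible metric, with the given topology. -/
abbrev IsCompatibleMetric.toMetricSpace {X : Type*} [TopologicalSpace X] {d : X → X → ℝ}
    (h : IsCompatibleMetric d) : MetricSpace X :=
  MetricSpace.ofDistTopology d h.self h.comm h.triangle h.isOpen_iff h.eq_of_zero

theorem mainTheorem6_general {V : Type u} {Edge : Type v} [Finite V] [Finite Edge] [Groupoid.{w} V]
    (E : DirectedGraph V Edge) (hsources : E.NoSources)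
    (A : SelfSimilarAction E) (hcontracting : A.IsContracting) (hregular : A.IsRegular) :
    ∃ φ : A.Solenoid ≃ₜ A.Solenoid,
      (∀ x : E.BiPath, φ (A.toSolenoid x) = A.toSolenoid x.translate) ∧
      (∃ (dJ : A.LimitSpace → A.LimitSpace → ℝ) (ε c : ℝ), A.IsExpandingMetric dJ ε c) ∧
      (∀ (dJ : A.LimitSpace → A.LimitSpace → ℝ) (ε c : ℝ), A.IsExpandingMetric dJ ε c →
        ∃ dS : A.Solenoid → A.Solenoid → ℝ,
          IsCompatibleMetric dS ∧
          (∀ x y : E.BiPath,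
            IsLUB
              (Set.range fun m : ℕ => (1 / c) ^ m *
                dJ (A.toLimitSpace (x.leftPart m)) (A.toLimitSpace (y.leftPart m)))
              (dS (A.toSolenoid x) (A.toSolenoid y))) ∧
          ∃ (εS : ℝ) (br : A.Solenoid → A.Solenoid → A.Solenoid),
            IsSmaleSpace dS φ εS (1 / c) br ∧
            HasTotallyDisconnectedStableSets dS φ εS br) ∧
      (E.StronglyConnected → IsIrreducibleHomeo φ) ∧
      (E.Primitive → IsMixingHomeo φ) := by
  refine ⟨A.translateSolenoid, SelfSimilarAction.translateSolenoid_toSolenoid,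
    SelfSimilarAction.exists_isExpandingMetric hsources hcontracting hregular, ?_,
    SelfSimilarAction.isIrreducibleHomeo_translateSolenoid,
    SelfSimilarAction.isMixingHomeo_translateSolenoid hsources⟩
  intro dJ ε c hdJ
  obtain ⟨hcompatible, hf⟩ := SelfSimilarAction.isExpandingMetric_iff.1 hdJ
  obtain ⟨N, hN⟩ := SelfSimilarAction.exists_isNucleus hsources hcontracting
  let _ : MetricSpace A.LimitSpace := hcompatible.toMetricSpace
  have hS := hN.isInverseLimit_solenoid hsources
  exact ⟨supDist c A.solenoidProj, isCompatibleMetric_supDist hf.one_lt hS.continuous hS.ext,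
    fun x y => isLUB_supDist (π := A.solenoidProj) hf.one_lt (A.toSolenoid x) (A.toSolenoid y),
    ε / 8, bracket ε A.solenoidProj, isSmaleSpace_of_isInverseLimit hf hS,
    hasTotallyDisconnectedStableSets_of_isInverseLimit hf hS⟩

theorem mainTheorem6 {V : Type u} {Edge : Type v} [Finite V] [Finite Edge] [Groupoid.{w} V]
    (E : DirectedGraph V Edge) (hsources : E.NoSources) (hsinks : E.NoSinks)
    (A : SelfSimilarAction E) (hcontracting : A.IsContracting) (hregular : A.IsRegular) :
    ∃ φ : A.Solenoid ≃ₜ A.Solenoid,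
      (∀ x : E.BiPath, φ (A.toSolenoid x) = A.toSolenoid x.translate) ∧
      (∃ (dJ : A.LimitSpace → A.LimitSpace → ℝ) (ε c : ℝ), A.IsExpandingMetric dJ ε c) ∧
      (∀ (dJ : A.LimitSpace → A.LimitSpace → ℝ) (ε c : ℝ), A.IsExpandingMetric dJ ε c →
        ∃ dS : A.Solenoid → A.Solenoid → ℝ,
          IsCompatibleMetric dS ∧
          (∀ x y : E.BiPath,
            IsLUB
              (Set.range fun m : ℕ => (1 / c) ^ m *
                dJ (A.toLimitSpace (x.leftPart m)) (A.toLimitSpace (y.leftPart m)))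
              (dS (A.toSolenoid x) (A.toSolenoid y))) ∧
          ∃ (εS : ℝ) (br : A.Solenoid → A.Solenoid → A.Solenoid),
            IsSmaleSpace dS φ εS (1 / c) br ∧
            HasTotallyDisconnectedStableSets dS φ εS br) ∧
      (E.StronglyConnected → IsIrreducibleHomeo φ) ∧
      (E.Primitive → IsMixingHomeo φ) :=
  mainTheorem6_general E hsources A hcontracting hregular
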